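/- **Conventions.** Let $X$ be a compact metrizable space, with a compatible metric $\mathrm{dist}$, and let $T\colon X\to X$ be a homeomorphism. The orbit of $x$ is $\mathrm{Orb}_T(x)=\{T^nx : n\in\mathbb Z\}$. The system $(X,T)$ is *aperiodic* if all orbits are infinite and *minimal* if all orbits are dense. Points $x,y$ are *asymptotic* if $\lim_{n\to+\infty}\mathrm{dist}(T^{-n}x,T^{-n}y)=0$ (this does not depend on the choice of the metric). Two orbits are *asymptotic* if some point of the first is asymptotic to some point of the second; this is an equivalence relation on the set of orbits. An *asymptotic component* of $(X,T)$ is an equivalence class containing more than one orbit. **$\mathcal S$-adic subshifts.** Let $\mathcal A$ be a finite alphabet and $\boldsymbol\tau=(\tau_n\colon\mathcal A^*\to\mathcal A^*)_{n\ge0}$ a sequence of non-erasing morphisms, i.e. $\tau_n(a)$ is never empty for $a\in\mathcal A$. For $N>0$ put $\tau_{[0,N)}=\tau_0\circ\tau_1\circ\cdots\circ\tau_{N-1}$. The $\mathcal S$-adic subshift $X_{\boldsymbol\tau}\subseteq\mathcal A^{\mathbb Z}$ is the set of all $x\in\mathcal A^{\mathbb Z}$ such that every finite word occurring in $x$ occurs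 in $\tau_{[0,N)}(a)$ for some $N>0$ and $a\in\mathcal A$, and $S$ is the shift map $(Sx)_n=x_{n+1}$. **Bratteli–Vershik systems and topological rank.** An ordered Bratteli diagram $B$ consists of finite vertex sets $V_0,V_1,\dots$ with $|V_0|=1$, finite edge sets $E_1,E_2,\dots$ with surjective source and range maps $E_n\to V_{n-1}$ and $E_n\to V_n$, and a partial order on each $E_n$ for which two edges are comparable if and only if they have the same range. It is *simple* if for each $n\ge1$ there is $N>n$ such that every vertex of $V_n$ is joined to every vertex of $V_N$ by a path. Let $X_B$ be the space of infinite paths starting in $V_0$, with the topology generated by cylinder sets. $B$ is *properly ordered* if there is exactly one path $x_{\max}\in X_B$ all of whose edges are maximal and exactly one path $x_{\min}\in X_B$ all of whose edges are minimal. In that case the Vershik map $V_B\colon X_B\to X_B$ sends $x_{\max}$ to $x_{\min}$; for $x\neq x_{\max}$, if $n$ is least such that $x_n$ is not maximal, it replaces $x_n$ by its successor, replaces the first $n-1$ edges by the minimal path from $V_0$ to the source of that successor, and keeps all later edges. A *Bratteli–Vershik representation* of $(X,T)$ is a simple properly ordered $B$ such that $(X_B,V_B)$ is topologically conjugate to $(X,T)$.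 The *topological rank* of $(X,T)$ is the least $d$ for which there is a representation with $|V_n|\le d$ for all $n$ ($+\infty$ if there is none). A *minimal Cantor system* is a minimal system on a Cantor set (a non-empty compact metrizable space with a countable basis of clopen sets and no isolated points). **Statement.** 1. Let $\mathcal A$ be an alphabet with exactly two letters and let $\boldsymbol\tau=(\tau_n\colon\mathcal A^*\to\mathcal A^*)_{n\ge0}$ be a sequence of non-erasing morphisms such that $(X_{\boldsymbol\tau},S)$ is aperiodic and minimal. Then $(X_{\boldsymbol\tau},S)$ has at most two asymptotic components. 2. Let $(X,T)$ be a minimal Cantor system of topological rank $2$. Then $(X,T)$ has exactly one asymptotic component. -/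

import Mathlib

open Filter Topology Uniformity

/-! ## Topological dynamical systems and their asymptotic components -/

section Dynamics

variable {X : Type*}

/-- The orbit `{T^n x : n ∈ ℤ}`. -/
def orbitOf [TopologicalSpace X] (T : X ≃ₜ X) (x : X) : Set X :=
  Set.range fun n : ℤ => (T ^ n) x

/-- Every orbit is infinite. -/
def IsAperiodicSystem [TopologicalSpace X] (T : X ≃ₜ X) : Prop :=
  ∀ x, (orbitOf T x).Infinite

/-- Every orbit is dense. -/
def IsMinimalSystem [TopologicalSpace X] (T : X ≃ₜ X) : Prop :=
  ∀ x, Dense (orbitOf T x)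

/-- `x` and `y` are (left) asymptotic: `T^{-n} x` and `T^{-n} y` become uniformly close as
`n → +∞`. On a compact Hausdorff space the uniformity is determined by the topology, so that
every compatible metric gives the same relation; see `isAsymptotic_iff_dist`. -/
def IsAsymptotic [UniformSpace X] (T : X ≃ₜ X) (x y : X) : Prop :=
  Tendsto (fun n : ℕ => ((T ^ (-(n : ℤ))) x, (T ^ (-(n : ℤ))) y)) atTop (𝓤 X)

theorem isAsymptotic_iff_dist [PseudoMetricSpace X] (T : X ≃ₜ X) (x y : X) :
    IsAsymptotic T x y ↔
      Tendsto (fun n : ℕ => dist ((T ^ (-(n : ℤ))) x) ((T ^ (-(n : ℤ))) y)) atTop (𝓝 0) :=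
  tendsto_uniformity_iff_dist_tendsto_zero

/-- Two orbits are asymptotic if some point of the one is asymptotic to some point of the other. -/
def OrbitsAsymptotic [UniformSpace X] (T : X ≃ₜ X) (O O' : Set X) : Prop :=
  ∃ x ∈ O, ∃ y ∈ O', IsAsymptotic T x y

/-- The asymptotic components: those classes of the relation `OrbitsAsymptotic T` on the
collection of orbits that contain more than one orbit. -/
def asymptoticComponents [UniformSpace X] (T : X ≃ₜ X) : Set (Set (Set X)) :=
  {C | (∃ O ∈ Set.range (orbitOf T),
      C = {O' | O' ∈ Set.range (orbitOf T) ∧ OrbitsAsymptotic T O O'}) ∧ C.Nontrivial}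

/-- A Cantor space: non-empty, compact, metrizable, with a countable basis of clopen sets and
without isolated points. -/
structure IsCantorSpace (X : Type*) [TopologicalSpace X] : Prop where
  nonempty : Nonempty X
  compact : CompactSpace X
  metrizable : TopologicalSpace.MetrizableSpace X
  clopen_basis : ∃ 𝓑 : Set (Set X), 𝓑.Countable ∧ TopologicalSpace.IsTopologicalBasis 𝓑 ∧
    ∀ U ∈ 𝓑, IsClopen U
  perfect : PerfectSpace X

end Dynamics

/-! ## `S`-adic subshifts -/

section Sadic

variable {A : Type*}

/-- The shift `(S x)_n = x_{n+1}` on two-sided sequences. -/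
def shiftHomeo (A : Type*) [TopologicalSpace A] : (ℤ → A) ≃ₜ (ℤ → A) where
  toFun x n := x (n + 1)
  invFun x n := x (n - 1)
  left_inv x := by funext n; simp
  right_inv x := by funext n; simp
  continuous_toFun := by fun_prop
  continuous_invFun := by fun_prop

/-- The word `x_m x_{m+1} ⋯ x_{m+ℓ-1}`. -/
def factorAt (x : ℤ → A) (m : ℤ) (ℓ : ℕ) : List A :=
  List.ofFn fun i : Fin ℓ => x (m + (i : ℕ))

/-- The image of the word `w` under `τ_{[n,n+k)} = τ_n ∘ τ_{n+1} ∘ ⋯ ∘ τ_{n+k-1}`, where each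
`τ_i : A → A^*` is extended to words by concatenation. -/
def blockImage (τ : ℕ → A → List A) (n : ℕ) : ℕ → List A → List A
  | 0, w => w
  | k + 1, w => blockImage τ n k (w.flatMap (τ (n + k)))

/-- The language of level `n`: the words that occur in `τ_{[n,N)}(a)` for some letter `a` and
some `N > n`. -/
def levelLanguage (τ : ℕ → A → List A) (n : ℕ) : Set (List A) :=
  {w | ∃ N, n < N ∧ ∃ a, w <:+: blockImage τ n (N - n) [a]}

/-- The `S`-adic subshift `X_τ`: the two-sided sequences all of whose factors belong to the
language of level `0`. -/
def sadicSubshift (τ : ℕ → A → List A) : Set (ℤ → A) :=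
  {x | ∀ m ℓ, factorAt x m ℓ ∈ levelLanguage τ 0}

theorem shift_mem_sadicSubshift [TopologicalSpace A] (τ : ℕ → A → List A) (x : ℤ → A) :
    x ∈ sadicSubshift τ ↔ shiftHomeo A x ∈ sadicSubshift τ := by
  have h (m : ℤ) (ℓ : ℕ) : factorAt (shiftHomeo A x) m ℓ = factorAt x (m + 1) ℓ := by
    unfold factorAt
    congr 1
    funext i
    change x (m + (i : ℕ) + 1) = x (m + 1 + (i : ℕ))
    rw [add_right_comm]
  constructor
  · intro hx m ℓ
    rw [h]
    exact hx _ _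
  · intro hx m ℓ
    have := hx (m - 1) ℓ
    rwa [h, sub_add_cancel] at this

/-- The shift on `X_τ`. -/
def sadicShift [TopologicalSpace A] (τ : ℕ → A → List A) :
    sadicSubshift τ ≃ₜ sadicSubshift τ :=
  (shiftHomeo A).subtype (shift_mem_sadicSubshift τ)

end Sadic

/-! ## Bratteli–Vershik systems -/

/-- An ordered Bratteli diagram. `E n` is the set of edges from level `n` to level `n + 1`. -/
structure OrderedBratteliDiagram where
  V : ℕ → Type
  E : ℕ → Type
  finite_V : ∀ n, Finite (V n)
  finite_E : ∀ n, Finite (E n)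
  unique_V_zero : Nonempty (Unique (V 0))
  source : ∀ {n}, E n → V n
  range : ∀ {n}, E n → V (n + 1)
  source_surjective : ∀ n, Function.Surjective (source (n := n))
  range_surjective : ∀ n, Function.Surjective (range (n := n))
  order : ∀ n, PartialOrder (E n)
  comparable_iff : ∀ {n} (e f : E n), (e ≤ f ∨ f ≤ e) ↔ range e = range f

namespace OrderedBratteliDiagram

variable (B : OrderedBratteliDiagram)

instance instFiniteE (n : ℕ) : Finite (B.E n) := B.finite_E n

instance instPartialOrderE (n : ℕ) : PartialOrder (B.E n) := B.order n

instance instTopologicalSpaceE (n : ℕ) : TopologicalSpace (B.E n) := ⊥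

instance instDiscreteTopologyE (n : ℕ) : DiscreteTopology (B.E n) := ⟨rfl⟩

/-- There is a finite path from `u` down to `v`. -/
inductive Joined : {n N : ℕ} → B.V n → B.V N → Prop
  | refl {n : ℕ} (u : B.V n) : Joined u u
  | step {n N : ℕ} {u : B.V n} (e : B.E N) : Joined u (B.source e) → Joined u (B.range e)

/-- The diagram is simple. -/
def IsSimple : Prop :=
  ∀ n, 1 ≤ n → ∃ N, n < N ∧ ∀ (u : B.V n) (v : B.V N), B.Joined u v

/-- The infinite paths from the top vertex. The topology induced from the product of the discrete
edge sets is the one with the cylinder sets as a basis. -/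
abbrev PathSpace : Type :=
  {x : ∀ n, B.E n // ∀ n, B.range (x n) = B.source (x (n + 1))}

/-- All edges of the path are maximal among the edges with the same range. -/
def IsMaxPath (x : B.PathSpace) : Prop := ∀ n, IsMax (x.1 n)

/-- All edges of the path are minimal among the edges with the same range. -/
def IsMinPath (x : B.PathSpace) : Prop := ∀ n, IsMin (x.1 n)

/-- The diagram is properly ordered. -/
def IsProperlyOrdered : Prop :=
  (∃! x, B.IsMaxPath x) ∧ ∃! x, B.IsMinPath x

/-- `y` is the image of `x` under the Vershik map: a maximal path goes to a minimal path, and if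
`n` is the first index such that `x n` is not maximal, then `y n` is the successor of `x n`, the
edges of `y` before `n` are minimal, and those after `n` are the edges of `x`. -/
def VershikRel (x y : B.PathSpace) : Prop :=
  (B.IsMaxPath x → B.IsMinPath y) ∧
  ∀ n, (∀ m < n, IsMax (x.1 m)) → ¬ IsMax (x.1 n) →
    (∀ m < n, IsMin (y.1 m)) ∧ x.1 n ⋖ y.1 n ∧ ∀ m, n < m → y.1 m = x.1 m

theorem exists_min_edge {n : ℕ} (v : B.V (n + 1)) : ∃ e : B.E n, IsMin e ∧ B.range e = v := by
  obtain ⟨e, rfl⟩ := B.range_surjective n v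
  obtain ⟨a, hae, ha⟩ := (Set.toFinite (Set.univ : Set (B.E n))).exists_le_minimal
    (Set.mem_univ e)
  exact ⟨a, fun b hb => ha.2 (Set.mem_univ b) hb, (B.comparable_iff a e).1 (Or.inl hae)⟩

theorem exists_min_initial (n : ℕ) (e : B.E n) : ∃ y : ∀ m, B.E m,
    y n = e ∧ ∀ m < n, IsMin (y m) ∧ B.range (y m) = B.source (y (m + 1)) := by
  induction n with
  | zero =>
    have hne (m : ℕ) : Nonempty (B.E m) := by
      induction m with
      | zero => exact ⟨e⟩
      | succ k ih =>
        obtain ⟨f⟩ := ih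
        obtain ⟨g, -⟩ := B.source_surjective (k + 1) (B.range f)
        exact ⟨g⟩
    classical
    exact ⟨Function.update (fun m => (hne m).some) 0 e, by simp, by simp⟩
  | succ k ih =>
    obtain ⟨f, hf, hfe⟩ := B.exists_min_edge (B.source e)
    obtain ⟨y, hy, hmin⟩ := ih f
    classical
    refine ⟨Function.update y (k + 1) e, by simp, fun m hm => ?_⟩
    rcases Nat.lt_succ_iff_lt_or_eq.1 hm with h | rfl
    · rw [Function.update_of_ne (by omega), Function.update_of_ne (by omega)]
      exact hmin m h
    · rw [Function.update_of_ne (by omega), Function.update_self, hy]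
      exact ⟨hf, hfe⟩

variable {B}

theorem eq_of_isMin_of_range_eq {n : ℕ} {e f : B.E n} (he : IsMin e) (hf : IsMin f)
    (h : B.range e = B.range f) : e = f := by
  rcases (B.comparable_iff e f).2 h with h | h
  · exact le_antisymm h (hf h)
  · exact le_antisymm (he h) h

theorem eq_of_covBy {n : ℕ} {e f g : B.E n} (hf : e ⋖ f) (hg : e ⋖ g) : f = g := by
  have h1 := (B.comparable_iff e f).1 (Or.inl hf.le)
  have h2 := (B.comparable_iff e g).1 (Or.inl hg.le)
  rcases (B.comparable_iff f g).2 (h1.symm.trans h2) with h | h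
  · exact h.eq_or_lt.resolve_right (hg.2 hf.lt)
  · exact (h.eq_or_lt.resolve_right (hf.2 hg.lt)).symm

theorem existsUnique_vershikRel (hB : B.IsProperlyOrdered) (x : B.PathSpace) :
    ∃! y, B.VershikRel x y := by
  classical
  by_cases hx : B.IsMaxPath x
  · obtain ⟨y, hy, huniq⟩ := hB.2
    exact ⟨y, ⟨fun _ => hy, fun n _ hn => absurd (hx n) hn⟩, fun z hz => huniq z (hz.1 hx)⟩
  · have hex : ∃ n, ¬ IsMax (x.1 n) := not_forall.1 hx
    set n := Nat.find hex with hn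
    have hnmax : ¬ IsMax (x.1 n) := Nat.find_spec hex
    have hlt : ∀ m < n, IsMax (x.1 m) := fun m hm => not_not.1 (Nat.find_min hex hm)
    have hunique : ∀ k, (∀ m < k, IsMax (x.1 m)) → ¬ IsMax (x.1 k) → k = n := by
      intro k hk hk'
      rcases lt_trichotomy k n with h | h | h
      · exact absurd (hlt k h) hk'
      · exact h
      · exact absurd (hk n h) hnmax
    have hsucc : ∃ f, x.1 n ⋖ f := by
      obtain ⟨b, hb⟩ := not_isMax_iff.1 hnmax
      obtain ⟨f, ⟨hf, hfm⟩⟩ := (Set.toFinite {c : B.E n | x.1 n < c}).exists_minimal ⟨b, hb⟩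
      exact ⟨f, hf, fun c hc hcf => not_lt_of_ge (hfm hc hcf.le) hcf⟩
    obtain ⟨f, hf⟩ := hsucc
    have hrange : B.range f = B.range (x.1 n) :=
      ((B.comparable_iff _ _).1 (Or.inl hf.le)).symm
    obtain ⟨y, hyn, hy⟩ := B.exists_min_initial n f
    let z : ∀ m, B.E m := fun m => if m ≤ n then y m else x.1 m
    have hz1 : ∀ m, m ≤ n → z m = y m := fun m hm => if_pos hm
    have hz2 : ∀ m, n < m → z m = x.1 m := fun m hm => if_neg (by omega)
    have hz : ∀ m, B.range (z m) = B.source (z (m + 1)) := by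
      intro m
      rcases lt_trichotomy m n with h | h | h
      · rw [hz1 m h.le, hz1 (m + 1) h]
        exact (hy m h).2
      · subst h
        rw [hz1 _ le_rfl, hz2 _ (Nat.lt_succ_self _), hyn, hrange]
        exact x.2 _
      · rw [hz2 m h, hz2 (m + 1) (by omega)]
        exact x.2 m
    refine ⟨⟨z, hz⟩, ⟨fun h => absurd h hx, fun k hk hk' => ?_⟩, fun w hw => ?_⟩
    · obtain rfl := hunique k hk hk'
      refine ⟨fun m hm => ?_, ?_, hz2⟩
      · change IsMin (z m)
        rw [hz1 m hm.le]
        exact (hy m hm).1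
      · change x.1 _ ⋖ z _
        rw [hz1 _ le_rfl, hyn]
        exact hf
    · obtain ⟨w1, w2, w3⟩ := hw.2 n hlt hnmax
      have hwn : w.1 n = z n := by
        rw [hz1 n le_rfl, hyn]
        exact eq_of_covBy w2 hf
      have hback : ∀ k, k ≤ n → w.1 (n - k) = z (n - k) := by
        intro k
        induction k with
        | zero => intro _; exact hwn
        | succ k ih =>
          intro hk
          have e1 : n - k = n - (k + 1) + 1 := by omega
          have h1 := ih (by omega)
          rw [e1] at h1
          refine eq_of_isMin_of_range_eq (w1 _ (by omega)) ?_ ?_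
          · rw [hz1 _ (by omega)]
            exact (hy _ (by omega)).1
          · rw [w.2, hz, h1]
      apply Subtype.ext
      funext m
      change w.1 m = z m
      rcases le_or_gt m n with h | h
      · have := hback (n - m) (by omega)
        rwa [Nat.sub_sub_self h] at this
      · rw [w3 m h, hz2 m h]

/-- The Vershik map of a properly ordered Bratteli diagram. -/
noncomputable def vershikMap (hB : B.IsProperlyOrdered) (x : B.PathSpace) : B.PathSpace :=
  (existsUnique_vershikRel hB x).choose

/-- `B` is a Bratteli–Vershik representation of `(X, T)`: it is simple and properly ordered, and
`(X, T)` is topologically conjugate to the Bratteli–Vershik system of `B`. -/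
def Represents (B : OrderedBratteliDiagram) {X : Type*} [TopologicalSpace X] (T : X ≃ₜ X) :
    Prop :=
  B.IsSimple ∧ ∃ hB : B.IsProperlyOrdered, ∃ φ : X ≃ₜ B.PathSpace,
    ∀ x, φ (T x) = vershikMap hB (φ x)

end OrderedBratteliDiagram

/-- The topological rank: the least `d` such that there is a Bratteli–Vershik representation with
at most `d` vertices on each level (`⊤` if there is no such `d`). -/
noncomputable def topologicalRank {X : Type*} [TopologicalSpace X] (T : X ≃ₜ X) : ℕ∞ :=
  sInf {d : ℕ∞ | ∃ k : ℕ, d = k ∧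
    ∃ B : OrderedBratteliDiagram, B.Represents T ∧ ∀ n, Nat.card (B.V n) ≤ k}

/-! ## Factorizations of two-sided sequences over two words -/

/-! Both parts rest on one combinatorial fact. Let the points of an aperiodic system be coded by
two-sided sequences that are concatenations of two words `u`, `v`. The words do not commute, for
otherwise the sequences would be periodic. Let `q` be the length of the longest common prefix of
`uv` and `vu`. From every cut one reads this prefix, so two sequences with a common cut and equal
labels up to some block separate exactly `q` letters after the cut where the labels first differ
(`exists_last_common_cut`). Moreover two factorizations of one left-infinite sequence must share
cuts, since a pigeonhole argument otherwise makes the sequence periodic (`exists_common_cut`).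
Hence, if two codings agree at all negative positions and differ at `0`, then `-q` is a cut
(`exists_cut_eq_neg`). Every asymptotic component contains such a splitting pair, so components are
counted by comparing the pasts of splitting points, using factorizations of all levels `n`, with
delays `q n`.

Part 1 (`exists_ne_leftTailEq`): all splitting points agree on `[-q n, 0)`. If `q n` is unbounded,
all pasts coincide. If at suitable levels both words are arbitrarily long, the pigeonhole principle
gives two among three splitting points with the same block before `-q n`, hence equal pasts on long
windows. If `q n` is bounded and one word stays short, aperiodicity makes the long word end within
bounded distance of `-q n`, and left tails agree up to a bounded shift. Three components are
therefore impossible.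

Part 2: for two vertices per level, the words of level `n` are the itineraries between visits to
minimal initial paths. The point just before a cut has a maximal initial path, and uniqueness of the
maximal path forces one common past there (`exists_level_common_past`). Together with the common
prefix, all splitting points have the same past (`pathCoding_eq_of_splitsAtZero`); a splitting pair
exists by compactness. Rank `2` excludes the odometers, for which the codings of all levels are
periodic; otherwise some level has an aperiodic coding, and that coding is injective
(`pathCoding_injective`). -/

section Factorization

variable {A : Type*}

/-- The sequence `z` is the concatenation of the words `w (l i)`, `i ∈ ℤ`, where the `i`-th word
starts at the position `c i`. -/
structure IsFactorization (w : Bool → List A) (z : ℤ → A) (c : ℤ → ℤ) (l : ℤ → Bool) : Prop where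
  step : ∀ i, c (i + 1) = c i + (w (l i)).length
  read : ∀ i, ∀ j < (w (l i)).length, (w (l i))[j]? = some (z (c i + (j : ℕ)))

/-- The words `uv` and `vu`, where `u` and `v` are the two values of `w`, have a longest common
prefix of length `q`, and differ at the next position. -/
def IsDelay (w : Bool → List A) (q : ℕ) : Prop :=
  (∀ j < q, (w false ++ w true)[j]? = (w true ++ w false)[j]?) ∧
    (w false ++ w true)[q]? ≠ (w true ++ w false)[q]?

theorem exists_isDelay {w : Bool → List A} (h : w false ++ w true ≠ w true ++ w false) :
    ∃ q, IsDelay w q := by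
  classical
  have hex : ∃ q : ℕ, (w false ++ w true)[q]? ≠ (w true ++ w false)[q]? := by
    by_contra! hcon
    exact h (List.ext_getElem? hcon)
  exact ⟨Nat.find hex, fun j hj => not_not.1 (Nat.find_min hex hj), Nat.find_spec hex⟩

theorem IsDelay.lt {w : Bool → List A} {q : ℕ} (h : IsDelay w q) (b : Bool) :
    q < (w b).length + (w (!b)).length := by
  by_contra! hq
  apply h.2
  rw [List.getElem?_eq_none, List.getElem?_eq_none] <;> cases b <;> simp at * <;> omega

theorem IsDelay.agree {w : Bool → List A} {q : ℕ} (h : IsDelay w q) (b : Bool) {j : ℕ}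
    (hj : j < q) : (w b ++ w (!b))[j]? = (w (!b) ++ w b)[j]? := by
  cases b
  · exact h.1 j hj
  · exact (h.1 j hj).symm

theorem IsDelay.differ {w : Bool → List A} {q : ℕ} (h : IsDelay w q) (b : Bool) :
    (w b ++ w (!b))[q]? ≠ (w (!b) ++ w b)[q]? := by
  cases b
  · exact h.2
  · exact h.2.symm

namespace IsFactorization

variable {w : Bool → List A} {z z' : ℤ → A} {c c' : ℤ → ℤ} {l l' : ℤ → Bool}

theorem cut_lt_succ (hw : ∀ b, w b ≠ []) (h : IsFactorization w z c l) (i : ℤ) :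
    c i < c (i + 1) := by
  have := List.length_pos_iff.2 (hw (l i))
  rw [h.step i]
  omega

theorem cut_add_le (hw : ∀ b, w b ≠ []) (h : IsFactorization w z c l) (i : ℤ) (r : ℕ) :
    c i + r ≤ c (i + r) := by
  induction r with
  | zero => simp
  | succ r ih =>
    have := h.cut_lt_succ hw (i + r)
    push_cast
    rw [← add_assoc, ← add_assoc]
    omega

theorem cut_le_add (h : IsFactorization w z c l) {M : ℕ} (hM : ∀ b, (w b).length ≤ M)
    (i : ℤ) (r : ℕ) : c (i + r) ≤ c i + r * M := by
  induction r with
  | zero => simp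
  | succ r ih =>
    have h1 := h.step (i + r)
    have h2 := hM (l (i + r))
    push_cast
    rw [← add_assoc, h1]
    zify at h2
    linarith

theorem strictMono (hw : ∀ b, w b ≠ []) (h : IsFactorization w z c l) : StrictMono c :=
  strictMono_int_of_lt_succ (h.cut_lt_succ hw)

/-- Every position lies in exactly one block. -/
theorem exists_block (hw : ∀ b, w b ≠ []) (h : IsFactorization w z c l) (t : ℤ) :
    ∃ i, ∃ j : ℕ, j < (w (l i)).length ∧ t = c i + j := by
  classical
  -- Blocks have length at least one, so `c` moves by at least `|i|` over `|i|` blocks; this bounds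
  -- the index of the block containing `t` and supplies the starting index.
  obtain ⟨i, hi, hmax⟩ := Int.exists_greatest_of_bdd (P := fun i => c i ≤ t)
    ⟨max 0 (t - c 0), fun i hi => by
      by_contra! hlt
      have h1 := h.cut_add_le hw 0 i.toNat
      rw [Int.toNat_of_nonneg (by omega), zero_add] at h1
      omega⟩
    ⟨min 0 (t - c 0), by
      have h1 := h.cut_add_le hw (min 0 (t - c 0)) (-min 0 (t - c 0)).toNat
      rw [Int.toNat_of_nonneg (by omega), add_neg_cancel] at h1
      omega⟩
  have h2 : t < c (i + 1) := by
    by_contra! hle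
    have := hmax _ hle
    omega
  rw [h.step] at h2
  exact ⟨i, (t - c i).toNat, by omega, by omega⟩

/-- A factorization at a cut reads the word `uv`, `u` being the next block and `v` the other
word, at least as far as `uv` and `vu` agree and one letter beyond. -/
theorem read_pair (hw : ∀ b, w b ≠ []) (h : IsFactorization w z c l) {Q : ℕ}
    (hQ : ∀ b, ∀ j < Q, (w b ++ w (!b))[j]? = (w (!b) ++ w b)[j]?) (i : ℤ) {j : ℕ}
    (hj : j ≤ Q) (hjl : j < (w (l i)).length + (w (!l i)).length) :
    (w (l i) ++ w (!l i))[j]? = some (z (c i + j)) := by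
  induction j using Nat.strong_induction_on generalizing i with
  | _ j ih =>
    by_cases hju : j < (w (l i)).length
    · rw [List.getElem?_append_left hju]
      exact h.read i j hju
    · push Not at hju
      obtain ⟨k, rfl⟩ := Nat.exists_eq_add_of_le hju
      have hu := List.length_pos_iff.2 (hw (l i))
      have hk : k < (w (!l i)).length := by omega
      have hpos : c i + ((w (l i)).length + k : ℕ) = c (i + 1) + k := by
        rw [h.step]; push_cast; ring
      rw [hpos, List.getElem?_append_right (by omega), Nat.add_sub_cancel_left]
      -- If `u` is followed by `u` again, the induction hypothesis reads `uv` from the second `u`.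
      -- As `k < Q`, this may be replaced by `vu`, so the letter is the one of `v`.
      by_cases hl : l (i + 1) = l i
      · have := ih k (by omega) (i + 1) (by omega) (by rw [hl]; omega)
        rw [hl, hQ _ _ (by omega), List.getElem?_append_left hk] at this
        exact this
      · have hl' : l (i + 1) = !l i := by
          cases h1 : l (i + 1) <;> cases h2 : l i <;> simp_all
        have := h.read (i + 1) k (by rw [hl']; exact hk)
        rw [← this, hl']

/-- A concatenation of two commuting words is periodic. -/
theorem periodic_of_commute (hw : ∀ b, w b ≠ []) (h : IsFactorization w z c l)
    (hc : w false ++ w true = w true ++ w false) (t : ℤ) :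
    z t = z (t + ((w false).length + (w true).length : ℕ)) := by
  have hcb : ∀ b, w b ++ w (!b) = w (!b) ++ w b := by
    rintro (_ | _)
    · exact hc
    · exact hc.symm
  have hlen : ∀ b, (w false).length + (w true).length = (w b).length + (w (!b)).length := by
    rintro (_ | _)
    · rfl
    · exact add_comm _ _
  have hW : ∀ b, w b ++ w (!b) = w false ++ w true := by
    rintro (_ | _)
    · rfl
    · exact hc.symm
  have key : ∀ i : ℤ, ∀ j < (w false).length + (w true).length,
      (w false ++ w true)[j]? = some (z (c i + j)) := fun i j hj => by
    rw [← hW (l i)]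
    exact h.read_pair hw (Q := (w false).length + (w true).length) (fun b j _ => by rw [hcb]) i
      hj.le (by rw [← hlen]; exact hj)
  obtain ⟨i, j, hj, rfl⟩ := h.exists_block hw t
  have h1 := key i j (by rw [hlen (l i)]; omega)
  -- The period is `|u| + |v|`: from the next cut one reads `vu = uv`, whose letter at `j + |v|` is
  -- the letter `j` of the present block `u`.
  have h2 := key (i + 1) (j + (w (!l i)).length) (by rw [hlen (l i)]; omega)
  have e : c (i + 1) + (j + (w (!l i)).length : ℕ)
      = c i + j + ((w false).length + (w true).length : ℕ) := by
    rw [h.step, hlen (l i)]; push_cast; ring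
  rw [e] at h2
  apply Option.some_injective
  rw [← h1, ← h2, ← hW (l i), List.getElem?_append_left hj, hcb (l i),
    List.getElem?_append_right (by omega), Nat.add_sub_cancel]

/-- From every cut one reads the longest common prefix of `uv` and `vu`. -/
theorem read_common_prefix (hw : ∀ b, w b ≠ []) {q : ℕ} (hq : IsDelay w q)
    (h : IsFactorization w z c l) (i : ℤ) {j : ℕ} (hj : j < q) :
    (w false ++ w true)[j]? = some (z (c i + j)) := by
  rw [← h.read_pair hw (fun b j hj => hq.agree b hj) i hj.le (hj.trans (hq.lt _))]
  cases l i
  · rfl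
  · exact hq.1 j hj

theorem cut_sub_eq_of_labels_eq (h : IsFactorization w z c l) (h' : IsFactorization w z' c' l')
    {i i' : ℤ} {r : ℕ} (hl : ∀ s : ℕ, s < r → l (i + s) = l' (i' + s)) :
    c (i + r) - c i = c' (i' + r) - c' i' := by
  induction r with
  | zero => simp
  | succ r ih =>
    have h1 := ih fun s hs => hl s (by omega)
    have h2 := hl r (by omega)
    push_cast
    rw [← add_assoc, ← add_assoc, h.step, h'.step, h2]
    linarith

theorem read_eq_of_labels_eq (hw : ∀ b, w b ≠ []) (h : IsFactorization w z c l)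
    (h' : IsFactorization w z' c' l') {i i' : ℤ} {r : ℕ}
    (hl : ∀ s : ℕ, s < r → l (i + s) = l' (i' + s)) {t : ℤ} (ht0 : 0 ≤ t)
    (ht : t < c (i + r) - c i) : z (c i + t) = z' (c' i' + t) := by
  obtain ⟨k, j, hj, hk⟩ := h.exists_block hw (c i + t)
  have hm := h.strictMono hw
  have hki : i < k + 1 := hm.lt_iff_lt.1 (by rw [h.step]; omega)
  have hkr : k < i + r := hm.lt_iff_lt.1 (by omega)
  obtain ⟨s, rfl⟩ : ∃ s : ℕ, k = i + s := ⟨(k - i).toNat, by omega⟩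
  have h1 := cut_sub_eq_of_labels_eq h h' (r := s) fun u hu => hl u (by omega)
  have h2 := hl s (by omega)
  have h3 := h.read _ j hj
  rw [h2] at hj h3
  have h4 := h'.read _ j hj
  rw [h3, ← hk] at h4
  rw [Option.some_injective _ h4]
  congr 1
  omega

/-- If two sequences read from cuts of factorizations over the same two words, then they separate
exactly `q` letters after the last common cut. -/
theorem exists_last_common_cut (hw : ∀ b, w b ≠ []) {q : ℕ} (hq : IsDelay w q)
    (h : IsFactorization w z c l) (h' : IsFactorization w z' c' l') {i i' : ℤ} {t : ℕ}
    (heq : ∀ s : ℕ, s < t → z (c i + s) = z' (c' i' + s)) (hne : z (c i + t) ≠ z' (c' i' + t)) :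
    ∃ r : ℕ, (∀ s : ℕ, s < r → l (i + s) = l' (i' + s)) ∧ c (i + r) = c i + t - q := by
  classical
  have hex : ∃ r : ℕ, l (i + r) ≠ l' (i' + r) := by
    by_contra! hcon
    refine hne (read_eq_of_labels_eq hw h h' (r := t + 1) (fun s _ => hcon s) (by omega) ?_)
    have := h.cut_add_le hw i (t + 1)
    push_cast at this ⊢
    omega
  have hlt : ∀ s : ℕ, s < Nat.find hex → l (i + s) = l' (i' + s) :=
    fun s hs => not_not.1 (Nat.find_min hex hs)
  have hr := Nat.find_spec hex
  set r := Nat.find hex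
  refine ⟨r, hlt, ?_⟩
  have hc := cut_sub_eq_of_labels_eq h h' hlt
  have hl : l' (i' + r) = !l (i + r) := by
    cases h1 : l (i + r) <;> cases h2 : l' (i' + r) <;> simp_all
  have hcr := h.cut_add_le hw i r
  have rd : ∀ j ≤ q, (w (l (i + r)) ++ w (!l (i + r)))[j]? = some (z (c (i + r) + j)) :=
    fun j hj => h.read_pair hw (fun b j hj => hq.agree b hj) _ hj
      (lt_of_le_of_lt hj (hq.lt _))
  have rd' : ∀ j ≤ q, (w (!l (i + r)) ++ w (l (i + r)))[j]? = some (z' (c' (i' + r) + j)) := by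
    intro j hj
    have := h'.read_pair hw (fun b j hj => hq.agree b hj) (i' + r) hj
      (lt_of_le_of_lt hj (hq.lt _))
    rwa [hl, Bool.not_not] at this
  have hsame : ∀ s : ℕ, (s : ℤ) < c (i + r) - c i + q → z (c i + s) = z' (c' i' + s) := by
    intro s hs
    by_cases hsr : (s : ℤ) < c (i + r) - c i
    · exact read_eq_of_labels_eq hw h h' hlt (by omega) hsr
    · obtain ⟨j, hj⟩ : ∃ j : ℕ, (s : ℤ) = c (i + r) - c i + j :=
        ⟨(s - (c (i + r) - c i)).toNat, by omega⟩
      have h1 := rd j (by omega)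
      rw [hq.agree _ (by omega), rd' j (by omega)] at h1
      have h2 := Option.some_injective _ h1
      rw [show c i + s = c (i + r) + j by omega, show c' i' + s = c' (i' + r) + j by omega, h2]
  have hdiff : z (c (i + r) + q) ≠ z' (c' (i' + r) + q) := fun he => by
    apply hq.differ (l (i + r))
    rw [rd q le_rfl, rd' q le_rfl, he]
  rcases lt_trichotomy (t : ℤ) (c (i + r) - c i + q) with h1 | h1 | h1
  -- Agreement before `q` letters past the cut and disagreement exactly there leave only one
  -- possible value for `t`.
  · exact absurd (hsame t h1) hne
  · omega
  · exfalso
    apply hdiff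
    have := heq (c (i + r) - c i + q).toNat (by omega)
    rw [Int.toNat_of_nonneg (by omega)] at this
    convert this using 2 <;> omega

/-- From a common cut on, factorizations of the same sequence coincide. -/
theorem labels_eq_of_common_cut (hw : ∀ b, w b ≠ []) {q : ℕ} (hq : IsDelay w q)
    (h : IsFactorization w z c l) (h' : IsFactorization w z c' l') {i i' : ℤ}
    (hcut : c i = c' i') (s : ℕ) : l (i + s) = l' (i' + s) := by
  induction s using Nat.strong_induction_on with
  | _ r ih =>
    by_contra hne
    have hc := cut_sub_eq_of_labels_eq h h' ih
    have hl : l' (i' + r) = !l (i + r) := by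
      cases h1 : l (i + r) <;> cases h2 : l' (i' + r) <;> simp_all
    have h1 := h.read_pair hw (fun b j hj => hq.agree b hj) (i + r) le_rfl (hq.lt _)
    have h2 := h'.read_pair hw (fun b j hj => hq.agree b hj) (i' + r) le_rfl (hq.lt _)
    rw [hl, Bool.not_not, show c' (i' + r) = c (i + r) by omega] at h2
    exact hq.differ _ (h1.trans h2.symm)

/-- Each cut of `z` lies in a block of `z'`, with a label and an offset: finitely many states. Take
two distant cuts in the same state. Were the rays from them to separate, both factorizations would
have a cut `q` letters before the first disagreement, which is a common cut. So the rays coincide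
and `z` is eventually periodic. -/
theorem exists_periodic_right_of_no_common_cut (hw : ∀ b, w b ≠ [])
    (hc : w false ++ w true ≠ w true ++ w false) (h : IsFactorization w z c l)
    (h' : IsFactorization w z' c' l') {t₀ : ℤ} (hz : ∀ t, t₀ ≤ t → z t = z' t)
    (hcut : ∀ i i', t₀ ≤ c i → c i ≠ c' i') :
    ∃ p : ℕ, 0 < p ∧ ∃ N : ℤ, ∀ t, N ≤ t → z t = z (t + p) := by
  obtain ⟨q, hq⟩ := exists_isDelay hc
  choose i' o ho hio using fun n : ℕ => h'.exists_block hw (c n)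
  obtain ⟨M, hM⟩ : ∃ M, ∀ b, (w b).length ≤ M :=
    ⟨max (w false).length (w true).length, by rintro (_ | _) <;> simp⟩
  -- The margin `M` makes the whole block of `z'` around the cut lie in the region where `z = z'`.
  obtain ⟨n₀, hn₀⟩ : ∃ n₀ : ℕ, ∀ n : ℕ, n₀ ≤ n → t₀ + M ≤ c n := by
    refine ⟨(t₀ + M - c 0).toNat, fun n hn => ?_⟩
    have := h.cut_add_le hw 0 n
    rw [zero_add] at this
    omega
  have hfin : (Set.range fun n : ℕ => (l' (i' n), o n)).Finite := by
    refine (Set.toFinite (Set.univ ×ˢ Set.Iio M)).subset ?_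
    rintro _ ⟨n, rfl⟩
    exact ⟨trivial, (ho n).trans_le (hM _)⟩
  obtain ⟨n, hn, m, hm, hnm, hstate⟩ := (Set.Ici_infinite n₀).exists_lt_map_eq_of_mapsTo
    (f := fun n : ℕ => (l' (i' n), o n)) (fun n _ => Set.mem_range_self n) hfin
  obtain ⟨hlab, hoff⟩ := Prod.mk.inj hstate
  simp only [Set.mem_Ici] at hn hm
  have hlt : c n < c m := h.strictMono hw (by exact_mod_cast hnm)
  have key : ∀ t : ℕ, z (c n + t) = z (c m + t) := by
    classical
    by_contra! hcon
    have hlow : ∀ s < Nat.find hcon, z (c n + s) = z (c m + s) :=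
      fun s hs => not_not.1 (Nat.find_min hcon hs)
    have hne := Nat.find_spec hcon
    set t := Nat.find hcon
    obtain ⟨r, hr, hcr⟩ := exists_last_common_cut hw hq h h hlow hne
    have hon := ho n
    have hom := ho m
    have hMn := hM (l' (i' n))
    have hMm := hM (l' (i' m))
    have hin := hio n
    have him := hio m
    have hn' := hn₀ n hn
    have hm' := hn₀ m hm
    have zn : ∀ s : ℕ, z' (c' (i' n) + s) = z (c' (i' n) + s) := fun s =>
      (hz _ (by omega)).symm
    have zm : ∀ s : ℕ, z' (c' (i' m) + s) = z (c' (i' m) + s) := fun s =>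
      (hz _ (by omega)).symm
    -- Inside the block, the letters before the cut agree because labels and offsets do; from the
    -- cut on, by minimality of `t`.
    have hlow' : ∀ s : ℕ, s < o n + t → z' (c' (i' n) + s) = z' (c' (i' m) + s) := by
      intro s hs
      by_cases hso : s < o n
      · have h1 := h'.read (i' n) s (by omega)
        have h2 := h'.read (i' m) s (by omega)
        rw [hlab, h2] at h1
        exact (Option.some_injective _ h1).symm
      · have := hlow (s - o n) (by omega)
        rw [zn, zm]
        convert this using 2 <;> omega
    have hne' : z' (c' (i' n) + (o n + t : ℕ)) ≠ z' (c' (i' m) + (o n + t : ℕ)) := by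
      rw [zn, zm, show c' (i' n) + (o n + t : ℕ) = c n + t by omega,
        show c' (i' m) + (o n + t : ℕ) = c m + t by omega]
      exact hne
    obtain ⟨r', -, hcr'⟩ := exists_last_common_cut hw hq h' h' hlow' hne'
    refine hcut (n + r) (i' n + r') ?_ ?_
    · have := h.cut_add_le hw n r
      omega
    · rw [hcr, hcr']
      push_cast
      omega
  refine ⟨(c m - c n).toNat, by omega, c n, fun t ht => ?_⟩
  have := key (t - c n).toNat
  convert this using 2 <;> omega

/-- With `t ↦ -1 - t`, right ends of blocks become left ends: block `i` of the reversal is block `-1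
- i`, and its cut is `-c (-i)`. This carries the statement on right tails over to left tails. -/
theorem reverse (h : IsFactorization w z c l) :
    IsFactorization (fun b => (w b).reverse) (fun t => z (-1 - t)) (fun i => -c (-i))
      (fun i => l (-1 - i)) := by
  have e : ∀ i : ℤ, c (-i) = c (-1 - i) + (w (l (-1 - i))).length := fun i => by
    rw [← h.step]; congr 1; ring
  refine ⟨fun i => ?_, fun i j hj => ?_⟩
  · rw [List.length_reverse, e i, show -(i + 1) = -1 - i by ring]
    ring
  · rw [List.length_reverse] at hj
    rw [List.getElem?_reverse hj, h.read _ _ (by omega), e i]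
    congr 2
    omega

/-- If the cuts of factorizations of the same left-infinite sequence are eventually disjoint, then
the sequence is eventually periodic. -/
theorem exists_periodic_left_of_no_common_cut (hw : ∀ b, w b ≠ [])
    (hc : w false ++ w true ≠ w true ++ w false) (h : IsFactorization w z c l)
    (h' : IsFactorization w z' c' l') {t₀ : ℤ} (hz : ∀ t, t < t₀ → z t = z' t)
    (hcut : ∀ i i', c i ≤ t₀ → c i ≠ c' i') :
    ∃ p : ℕ, 0 < p ∧ ∃ N : ℤ, ∀ t, t ≤ N → z t = z (t + p) := by
  obtain ⟨p, hp, N, hN⟩ := exists_periodic_right_of_no_common_cut (t₀ := -t₀)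
    (fun b => by simpa using hw b)
    (fun he => hc (List.reverse_injective (by simpa using he.symm))) h.reverse h'.reverse
    (fun t ht => hz _ (by omega))
    (fun i i' hi he => hcut (-i) (-i') (by omega) (by omega))
  refine ⟨p, hp, -1 - N - p, fun t ht => ?_⟩
  have := hN (-1 - t - p) (by omega)
  rw [show -1 - (-1 - t - p) = t + p by ring, show -1 - (-1 - t - p + p) = t by ring] at this
  exact this.symm

end IsFactorization

end Factorization

/-! ## Symbolic codings of dynamical systems -/

section Coding

/-- Compactness in the form used throughout: a condition that fails for each point at some stage
fails for all points at a common stage. -/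
theorem exists_forall_notMem_of_antitone {X : Type*} [TopologicalSpace X] [CompactSpace X]
    {F : ℕ → Set X} (hF : Antitone F) (hcl : ∀ n, IsClosed (F n)) (h : ∀ x, ∃ n, x ∉ F n) :
    ∃ n, ∀ x, x ∉ F n := by
  by_contra! hcon
  obtain ⟨x, hx⟩ := IsCompact.nonempty_iInter_of_sequence_nonempty_isCompact_isClosed F
    (fun n => hF n.le_succ) hcon (hcl 0).isCompact hcl
  obtain ⟨n, hn⟩ := h x
  exact hn (Set.mem_iInter.1 hx n)

variable {X A : Type*}

theorem orbitOf_zpow_apply [TopologicalSpace X] (T : X ≃ₜ X) (n : ℤ) (x : X) :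
    orbitOf T ((T ^ n) x) = orbitOf T x := by
  ext y
  constructor
  · rintro ⟨m, rfl⟩
    exact ⟨m + n, by simp only [zpow_add]; rfl⟩
  · rintro ⟨m, rfl⟩
    exact ⟨m - n, by
      change (T ^ (m - n) * T ^ n) x = _
      rw [← zpow_add, sub_add_cancel]⟩

theorem mem_orbitOf_self [TopologicalSpace X] (T : X ≃ₜ X) (x : X) : x ∈ orbitOf T x :=
  ⟨0, rfl⟩

/-- An equivariant map from `X` to two-sided sequences, continuous for the discrete topology
on `A`. -/
structure IsCoding [TopologicalSpace X] (T : X ≃ₜ X) (f : X → ℤ → A) : Prop where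
  locallyConstant : ∀ t, IsLocallyConstant fun x => f x t
  apply_map : ∀ x t, f (T x) t = f x (t + 1)

/-- No point is coded by a periodic sequence. -/
def IsAperiodicCoding (f : X → ℤ → A) : Prop :=
  ∀ x, ∀ p : ℕ, 0 < p → ∃ t, f x t ≠ f x (t + p)

theorem IsAperiodicCoding.not_commute {f : X → ℤ → A} (hap : IsAperiodicCoding f)
    {w : Bool → List A} (hw : ∀ b, w b ≠ []) {c : ℤ → ℤ} {l : ℤ → Bool} {x : X}
    (h : IsFactorization w (f x) c l) : w false ++ w true ≠ w true ++ w false := fun he => by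
  obtain ⟨t, ht⟩ := hap x ((w false).length + (w true).length)
    (by have := List.length_pos_iff.2 (hw false); omega)
  exact ht (h.periodic_of_commute hw he t)

/-- The sequences coding `x` and `y` agree at negative positions and differ at `0`. -/
def SplitsAtZero (f : X → ℤ → A) (x y : X) : Prop :=
  (∀ t < 0, f x t = f y t) ∧ f x 0 ≠ f y 0

/-- Some shift of the sequence coding `y` agrees with the sequence coding `x` far to the left. -/
def LeftTailEq (f : X → ℤ → A) (x y : X) : Prop :=
  ∃ k N : ℤ, ∀ t < N, f x t = f y (t + k)

theorem LeftTailEq.symm {f : X → ℤ → A} {x y : X} (h : LeftTailEq f x y) : LeftTailEq f y x := by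
  obtain ⟨k, N, h⟩ := h
  exact ⟨-k, N + k, fun t ht => by rw [h (t + -k) (by omega), neg_add_cancel_right]⟩

theorem LeftTailEq.trans {f : X → ℤ → A} {x y z : X} (h : LeftTailEq f x y)
    (h' : LeftTailEq f y z) : LeftTailEq f x z := by
  obtain ⟨k, N, h⟩ := h
  obtain ⟨k', N', h'⟩ := h'
  exact ⟨k + k', min N (N' - k), fun t ht => by
    rw [h t (by omega), h' (t + k) (by omega), add_assoc]⟩

theorem leftTailEq_of_forall_lt_zero {f : X → ℤ → A} {x y : X} (h : ∀ t < 0, f x t = f y t) :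
    LeftTailEq f x y := ⟨0, 0, fun t ht => by rw [h t ht, add_zero]⟩

namespace IsCoding

section Topological

variable [TopologicalSpace X] {T : X ≃ₜ X} {f : X → ℤ → A}

theorem apply_zpow (hf : IsCoding T f) (n : ℤ) (x : X) (t : ℤ) :
    f ((T ^ n) x) t = f x (t + n) := by
  induction n using Int.induction_on generalizing t with
  | zero => simp
  | succ n ih =>
    rw [add_comm (n : ℤ) 1, zpow_one_add, Homeomorph.mul_apply]
    rw [hf.apply_map, ih]
    congr 1; ring
  | pred n ih =>
    have h1 := hf.apply_map ((T ^ (-(n : ℤ) - 1)) x) (t - 1)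
    have h2 : T ((T ^ (-(n : ℤ) - 1)) x) = (T ^ (-(n : ℤ))) x := by
      change (T * T ^ (-(n : ℤ) - 1)) x = _
      rw [mul_self_zpow, sub_add_cancel]
    rw [h2, ih, sub_add_cancel] at h1
    rw [← h1]
    congr 1; ring

theorem isClopen_agree (hf : IsCoding T f) (s t : ℤ) : IsClopen {x | f x s = f x t} := by
  have h := ((hf.locallyConstant s).prodMk (hf.locallyConstant t)).comp fun a : A × A => a.1 = a.2
  simpa [Function.comp_def] using h.isClopen_fiber True

theorem isClopen_agree_pair (hf : IsCoding T f) (t : ℤ) :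
    IsClopen {a : X × X | f a.1 t = f a.2 t} := by
  have h := (((hf.locallyConstant t).comp_continuous continuous_fst).prodMk
    ((hf.locallyConstant t).comp_continuous continuous_snd)).comp fun a : A × A => a.1 = a.2
  simpa [Function.comp_def] using h.isClopen_fiber True

variable [CompactSpace X]

/-- In a compact aperiodic system there are no long repetitions of a given period. -/
theorem exists_bound_repetition (hf : IsCoding T f) (hap : IsAperiodicCoding f) {p : ℕ}
    (hp : 0 < p) : ∃ L : ℕ, ∀ x, ∀ t : ℤ, ∃ s : ℕ, s < L ∧ f x (t + s) ≠ f x (t + s + p) := by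
  obtain ⟨n, hn⟩ := exists_forall_notMem_of_antitone
    (F := fun n : ℕ => ⋂ s ∈ {s : ℤ | |s| ≤ n}, {x | f x s = f x (s + p)})
    (fun n m hnm => Set.biInter_subset_biInter_left fun s (hs : |s| ≤ n) =>
      hs.trans (by exact_mod_cast hnm))
    (fun n => isClosed_biInter fun s _ => (hf.isClopen_agree s (s + p)).isClosed)
    (fun x => by
      obtain ⟨t, ht⟩ := hap x p hp
      exact ⟨t.natAbs, fun h => ht (Set.mem_iInter₂.1 h t (by simp))⟩)
  -- The symmetric window of radius `n`, moved to the centre `t + n`, is the window of length `2 * n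
  -- + 1` that starts at `t`.
  refine ⟨2 * n + 1, fun x t => ?_⟩
  have h := hn ((T ^ (t + n)) x)
  simp only [Set.mem_iInter, not_forall, Set.mem_ofPred_eq, hf.apply_zpow] at h
  obtain ⟨s, hs, hne⟩ := h
  rw [abs_le] at hs
  refine ⟨(s + n).toNat, by omega, ?_⟩
  rw [Int.toNat_of_nonneg (by omega)]
  convert hne using 2 <;> ring_nf

/-- An aperiodic system has two points whose codings agree at the negative positions and differ
at `0`. -/
theorem exists_splitsAtZero [Nonempty X] (hf : IsCoding T f) (hap : IsAperiodicCoding f) :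
    ∃ x y, SplitsAtZero f x y := by
  by_contra! hcon
  obtain ⟨n, hn⟩ := exists_forall_notMem_of_antitone
    (F := fun n : ℕ => (⋂ s ∈ {s : ℤ | -n ≤ s ∧ s < 0}, {a : X × X | f a.1 s = f a.2 s}) ∩
      {a : X × X | f a.1 0 = f a.2 0}ᶜ)
    (fun n m hnm => Set.inter_subset_inter_left _ <|
      Set.biInter_subset_biInter_left fun s (hs : -n ≤ s ∧ s < 0) =>
        (⟨by omega, hs.2⟩ : -(m : ℤ) ≤ s ∧ s < 0))
    (fun n => (isClosed_biInter fun s _ => (hf.isClopen_agree_pair s).isClosed).inter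
      (hf.isClopen_agree_pair 0).compl.isClosed)
    (fun a => by
      by_contra! hmem
      refine hcon a.1 a.2 ⟨fun t ht => ?_, (hmem 0).2⟩
      exact Set.mem_iInter₂.1 (hmem t.natAbs).1 t ⟨by omega, ht⟩)
  -- Without splitting pairs, compactness makes each letter a function of the `n` letters before it.
  -- A repeated window then repeats its whole future, against the bound on repetitions.
  have hdet : ∀ x y, (∀ s : ℤ, -n ≤ s → s < 0 → f x s = f y s) → f x 0 = f y 0 := by
    intro x y h
    by_contra hne
    exact hn (x, y) ⟨Set.mem_iInter₂.2 fun s hs => h s hs.1 hs.2, hne⟩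
  obtain ⟨x⟩ := ‹Nonempty X›
  have hfin : (Set.range fun (t : ℕ) (i : Fin n) => f x (t + (i : ℕ))).Finite := by
    have hrange := (hf.locallyConstant 0).range_finite
    refine (Set.Finite.pi' fun _ : Fin n => hrange).subset ?_
    rintro _ ⟨t, rfl⟩ i
    exact ⟨(T ^ ((t : ℤ) + (i : ℕ))) x, by simp [hf.apply_zpow]⟩
  obtain ⟨s, t, hst, heq⟩ := Set.Finite.exists_lt_map_eq_of_forall_mem
    (f := fun (t : ℕ) (i : Fin n) => f x (t + (i : ℕ))) (fun t => Set.mem_range_self t) hfin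
  have key : ∀ k : ℕ, f x (s + k) = f x (t + k) := by
    intro k
    induction k using Nat.strong_induction_on with
    | _ k ih =>
      by_cases hk : k < n
      · exact congrFun heq ⟨k, hk⟩
      · have h := hdet ((T ^ ((s : ℤ) + k)) x) ((T ^ ((t : ℤ) + k)) x) fun r hr hr0 => by
          rw [hf.apply_zpow, hf.apply_zpow]
          have := ih (k + r).toNat (by omega)
          rw [Int.toNat_of_nonneg (by omega)] at this
          convert this using 2 <;> ring
        simpa [hf.apply_zpow] using h
  obtain ⟨L, hL⟩ := hf.exists_bound_repetition hap (p := t - s) (by omega)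
  obtain ⟨k, -, hk⟩ := hL x s
  apply hk
  rw [key k]
  congr 1
  push_cast [Nat.cast_sub hst.le]
  ring

section Factorizations

variable {w : Bool → List A} {c c' : ℤ → ℤ} {l l' : ℤ → Bool} {x y : X}

/-- Recognizability: factorizations of sequences with the same left tail have common cuts. -/
theorem exists_common_cut (hf : IsCoding T f) (hap : IsAperiodicCoding f) (hw : ∀ b, w b ≠ [])
    (h : IsFactorization w (f x) c l) (h' : IsFactorization w (f y) c' l') {t₀ : ℤ}
    (hxy : ∀ t < t₀, f x t = f y t) : ∃ i i', c i ≤ t₀ ∧ c i = c' i' := by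
  by_contra! hcon
  obtain ⟨p, hp, N, hN⟩ := h.exists_periodic_left_of_no_common_cut hw
    (hap.not_commute hw h) h' hxy hcon
  obtain ⟨L, hL⟩ := hf.exists_bound_repetition hap hp
  obtain ⟨s, hs, hne⟩ := hL x (N - L)
  exact hne (hN _ (by omega))

/-- In a factorization, two sequences that split at `0` split at a fixed distance from a cut. -/
theorem exists_cut_eq_neg (hf : IsCoding T f) (hap : IsAperiodicCoding f) (hw : ∀ b, w b ≠ [])
    {q : ℕ} (hq : IsDelay w q) (h : IsFactorization w (f x) c l)
    (h' : IsFactorization w (f y) c' l') (hxy : SplitsAtZero f x y) : ∃ i, c i = -q := by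
  obtain ⟨i, i', hi, hcut⟩ := hf.exists_common_cut hap hw h h' hxy.1
  -- Counted from the common cut `c i ≤ 0`, the first disagreement is at `t = -c i`, so the last
  -- common cut is at `-q`.
  obtain ⟨r, -, hr⟩ := IsFactorization.exists_last_common_cut hw hq h h' (i := i) (i' := i')
    (t := (-c i).toNat)
    (fun s hs => by rw [← hcut]; exact hxy.1 _ (by omega))
    (by
      rw [← hcut, Int.toNat_of_nonneg (by omega), add_neg_cancel]
      exact hxy.2)
  exact ⟨i + r, by omega⟩

end Factorizations

end Topological

section Uniform

variable [UniformSpace X] [CompactSpace X] {T : X ≃ₜ X} {f : X → ℤ → A}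

/-- By compactness every neighbourhood of the diagonal is an entourage, so agreement at the letter
`0` is one. Conversely, an injective coding makes agreement on a large enough window finer than any
given entourage. -/
theorem isAsymptotic_iff (hf : IsCoding T f) (hinj : Function.Injective f) (x y : X) :
    IsAsymptotic T x y ↔ ∃ N : ℤ, ∀ t < N, f x t = f y t := by
  constructor
  · intro h
    have hU : {a : X × X | f a.1 0 = f a.2 0} ∈ 𝓤 X := by
      rw [← nhdsSet_diagonal_eq_uniformity]
      exact (hf.isClopen_agree_pair 0).isOpen.mem_nhdsSet.2 fun a ha => by
        rw [Set.mem_ofPred_eq, Set.mem_diagonal_iff.1 ha]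
    obtain ⟨n, hn⟩ := eventually_atTop.1 (h.eventually hU)
    refine ⟨-n, fun t ht => ?_⟩
    have := hn (-t).toNat (by omega)
    simpa [hf.apply_zpow, Int.toNat_of_nonneg (show 0 ≤ -t by omega)] using this
  · rintro ⟨N, hN⟩ V hV
    obtain ⟨n, hn⟩ := exists_forall_notMem_of_antitone
      (F := fun n : ℕ => (⋂ s ∈ {s : ℤ | |s| ≤ n}, {a : X × X | f a.1 s = f a.2 s}) ∩
        (interior V)ᶜ)
      (fun n m hnm => Set.inter_subset_inter_left _ <|
        Set.biInter_subset_biInter_left fun s (hs : |s| ≤ n) => hs.trans (by exact_mod_cast hnm))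
      (fun n => (isClosed_biInter fun s _ => (hf.isClopen_agree_pair s).isClosed).inter
        isOpen_interior.isClosed_compl)
      (fun a => by
        by_contra! hmem
        obtain ⟨a, b⟩ := a
        obtain rfl : a = b := hinj <| funext fun t =>
          Set.mem_iInter₂.1 (hmem t.natAbs).1 t (by simp)
        refine (hmem 0).2 ?_
        exact refl_mem_uniformity (interior_mem_uniformity hV))
    rw [mem_map, mem_atTop_sets]
    refine ⟨(n - N + 1).toNat, fun m hm => ?_⟩
    by_contra hmem
    refine hn _ ⟨Set.mem_iInter₂.2 fun s hs => ?_, fun h => hmem (show _ ∈ V from interior_subset h)⟩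
    have hs' : |s| ≤ n := hs
    rw [abs_le] at hs'
    rw [Set.mem_ofPred_eq, hf.apply_zpow, hf.apply_zpow]
    exact hN _ (by omega)

theorem orbitsAsymptotic_iff (hf : IsCoding T f) (hinj : Function.Injective f) (x y : X) :
    OrbitsAsymptotic T (orbitOf T x) (orbitOf T y) ↔ LeftTailEq f x y := by
  constructor
  · rintro ⟨_, ⟨n, rfl⟩, _, ⟨m, rfl⟩, h⟩
    obtain ⟨N, hN⟩ := (hf.isAsymptotic_iff hinj _ _).1 h
    refine ⟨m - n, N + n, fun t ht => ?_⟩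
    have := hN (t - n) (by omega)
    simp only [hf.apply_zpow, sub_add_cancel] at this
    rw [this]
    congr 1; ring
  · rintro ⟨k, N, hN⟩
    refine ⟨x, mem_orbitOf_self T x, (T ^ k) y, ⟨k, rfl⟩, (hf.isAsymptotic_iff hinj _ _).2
      ⟨N, fun t ht => ?_⟩⟩
    rw [hf.apply_zpow, hN t ht]

/-- The class of the orbit of `x` under the relation `OrbitsAsymptotic`. -/
def _root_.asymptoticClass (T : X ≃ₜ X) (x : X) : Set (Set X) :=
  {O | O ∈ Set.range (orbitOf T) ∧ OrbitsAsymptotic T (orbitOf T x) O}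

theorem asymptoticClass_eq (hf : IsCoding T f) (hinj : Function.Injective f) {x y : X}
    (h : LeftTailEq f x y) : asymptoticClass T x = asymptoticClass T y := by
  ext O
  constructor
  · rintro ⟨⟨z, rfl⟩, hO⟩
    exact ⟨⟨z, rfl⟩, (hf.orbitsAsymptotic_iff hinj _ _).2
      (h.symm.trans ((hf.orbitsAsymptotic_iff hinj _ _).1 hO))⟩
  · rintro ⟨⟨z, rfl⟩, hO⟩
    exact ⟨⟨z, rfl⟩, (hf.orbitsAsymptotic_iff hinj _ _).2
      (h.trans ((hf.orbitsAsymptotic_iff hinj _ _).1 hO))⟩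

/-- Every asymptotic component is the class of a point that splits at `0` from another one. -/
theorem exists_splitsAtZero_of_mem (hf : IsCoding T f) (hinj : Function.Injective f)
    {C : Set (Set X)} (hC : C ∈ asymptoticComponents T) :
    ∃ x y, SplitsAtZero f x y ∧ C = asymptoticClass T x := by
  obtain ⟨⟨_, ⟨x, rfl⟩, rfl⟩, hnt⟩ := hC
  obtain ⟨_, ⟨⟨y, rfl⟩, hO⟩, hne⟩ := hnt.exists_ne (orbitOf T x)
  obtain ⟨k, N, hN⟩ := (hf.orbitsAsymptotic_iff hinj _ _).1 hO
  have hex : ∃ t, f x t ≠ f y (t + k) := by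
    by_contra! hcon
    apply hne
    rw [← orbitOf_zpow_apply T k y]
    congr 1
    exact hinj (funext fun t => by rw [hcon t, hf.apply_zpow])
  -- Moving both points to the first disagreement, which exists because the sequences agree to the
  -- left of `N`, gives a pair that splits at `0`.
  obtain ⟨t, ht, hmin⟩ := Int.exists_least_of_bdd ⟨N, fun s hs => by
    by_contra! hlt
    exact hs (hN s hlt)⟩ hex
  refine ⟨(T ^ t) x, (T ^ (t + k)) y, ⟨fun s hs => ?_, ?_⟩, ?_⟩
  · rw [hf.apply_zpow, hf.apply_zpow, ← add_assoc]
    by_contra hne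
    have := hmin _ hne
    omega
  · simpa [hf.apply_zpow] using ht
  · rw [← orbitOf_zpow_apply T t x]
    rfl

/-- The class of a point that splits at `0` from another one is an asymptotic component. -/
theorem asymptoticClass_mem (hf : IsCoding T f) (hinj : Function.Injective f)
    (hap : IsAperiodicCoding f) {x y : X} (h : SplitsAtZero f x y) :
    asymptoticClass T x ∈ asymptoticComponents T := by
  refine ⟨⟨_, ⟨x, rfl⟩, rfl⟩, orbitOf T x, ⟨⟨x, rfl⟩, ?_⟩, orbitOf T y, ⟨⟨y, rfl⟩, ?_⟩, ?_⟩
  · exact (hf.orbitsAsymptotic_iff hinj _ _).2 (leftTailEq_of_forall_lt_zero fun _ _ => rfl)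
  · exact (hf.orbitsAsymptotic_iff hinj _ _).2 (leftTailEq_of_forall_lt_zero h.1)
  -- If `y = T^k x`, then `k` is a period of the negative half of the coding of `x`, and such long
  -- repetitions do not exist.
  · intro he
    obtain ⟨k, hk⟩ : y ∈ orbitOf T x := he ▸ mem_orbitOf_self T y
    have hk' : (T ^ k) x = y := hk
    have hper : ∀ t < 0, f x t = f x (t + k) := fun t ht => by
      rw [h.1 t ht, ← hk', hf.apply_zpow]
    have hk0 : k ≠ 0 := by
      rintro rfl
      exact h.2 (by rw [← hk']; rfl)
    obtain ⟨L, hL⟩ := hf.exists_bound_repetition hap (p := k.natAbs) (by omega)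
    obtain ⟨s, hs, hne⟩ := hL x (-L - k.natAbs)
    apply hne
    rcases le_or_gt 0 k with hk1 | hk1
    · rw [hper _ (by omega)]
      congr 1; omega
    · rw [hper (-L - k.natAbs + s + k.natAbs) (by omega)]
      congr 1; omega

end Uniform

end IsCoding

end Coding

/-! ### Two among three splitting points share a left tail -/

section Counting

variable {X A : Type*}

namespace IsFactorization

variable {w : Bool → List A} {z z' : ℤ → A} {c c' : ℤ → ℤ} {l l' : ℤ → Bool}

theorem cut_eq_of_labels_const (h : IsFactorization w z c l) {i : ℤ} {r : ℕ} {a : Bool}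
    (hl : ∀ s : ℕ, s < r → l (i + s) = a) : c (i + r) = c i + r * (w a).length := by
  induction r with
  | zero => simp
  | succ r ih =>
    have h1 := ih fun s hs => hl s (by omega)
    have h2 := hl r (by omega)
    push_cast
    rw [← add_assoc, h.step, h1, h2]
    ring

theorem read_before (h : IsFactorization w z c l) (i : ℤ) {t : ℕ} (ht : 0 < t)
    (htl : t ≤ (w (l (i - 1))).length) :
    (w (l (i - 1)))[(w (l (i - 1))).length - t]? = some (z (c i - t)) := by
  rw [h.read _ _ (by omega)]
  have := h.step (i - 1)
  rw [sub_add_cancel] at this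
  rw [this]
  congr 2
  omega

end IsFactorization

namespace IsCoding

variable [TopologicalSpace X] [CompactSpace X] {T : X ≃ₜ X} {f : X → ℤ → A}

/-- If one of the two words is short, then the other word occurs shortly before every cut. -/
theorem exists_recent_block (hf : IsCoding T f) (hap : IsAperiodicCoding f) (K : ℕ) :
    ∃ L : ℕ, ∀ (w : Bool → List A) (_ : ∀ b, w b ≠ []) (x : X) (c : ℤ → ℤ) (l : ℤ → Bool)
      (_ : IsFactorization w (f x) c l) (a : Bool) (_ : (w a).length < K) (k : ℤ),
      ∃ i, l (i - 1) = !a ∧ c i ≤ c k ∧ c k ≤ c i + L := by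
  choose! L hL using fun (p : ℕ) (hp : 0 < p) => hf.exists_bound_repetition hap hp
  -- The bound must not depend on the words: the sum covers all periods below `K` and bounds the
  -- number of consecutive short blocks; the factor `K` bounds their lengths.
  refine ⟨(∑ p ∈ Finset.range K, L p) * K, fun w hw x c l h a ha k => ?_⟩
  have hpos := List.length_pos_iff.2 (hw a)
  have hle : L (w a).length ≤ ∑ p ∈ Finset.range K, L p :=
    Finset.single_le_sum (f := L) (fun _ _ => Nat.zero_le _) (Finset.mem_range.2 ha)
  set M := ∑ p ∈ Finset.range K, L p
  have hex : ∃ r : ℕ, r ≤ M ∧ l (k - r - 1) = !a := by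
    -- A run of `M + 1` blocks `w a` has period `|w a|` over at least `M` letters, more than
    -- aperiodicity allows.
    by_contra! hcon
    have hcon' : ∀ r : ℕ, r ≤ M → l (k - r - 1) = a := fun r hr => by
      have := hcon r hr
      cases h1 : l (k - r - 1) <;> cases a <;> simp_all
    have hlab : ∀ s : ℕ, s < M → l (k - M - 1 + s) = l (k - M - 1 + 1 + s) := fun s hs => by
      have h1 := hcon' (M - s) (by omega)
      have h2 := hcon' (M - s - 1) (by omega)
      rw [show k - M - 1 + s = k - (M - s : ℕ) - 1 by omega,
        show k - M - 1 + 1 + s = k - (M - s - 1 : ℕ) - 1 by omega, h1, h2]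
    obtain ⟨s, hs, hne⟩ := hL _ hpos x (c (k - M - 1))
    apply hne
    have hlen := h.cut_add_le hw (k - M - 1) M
    rw [IsFactorization.read_eq_of_labels_eq hw h h hlab (t := s) (by omega) (by omega), h.step,
      hcon' M le_rfl]
    congr 1; ring
  classical
  obtain ⟨hr, hlr⟩ := Nat.find_spec hex
  have hmin : ∀ s < Nat.find hex, l (k - s - 1) = a := fun s hs => by
    refine (Bool.eq_or_eq_not _ a).resolve_right fun hne => Nat.find_min hex hs ⟨by omega, hne⟩
  set r := Nat.find hex
  have hcut := h.cut_eq_of_labels_const (i := k - r) (r := r) (a := a) fun s hs => by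
    have := hmin (r - s - 1) (by omega)
    rw [← this]
    congr 1; omega
  rw [sub_add_cancel] at hcut
  refine ⟨k - r, hlr, ?_, ?_⟩
  · rw [hcut]
    have : (0 : ℤ) ≤ r * (w a).length := by positivity
    omega
  · have : r * (w a).length ≤ M * K := Nat.mul_le_mul hr ha.le
    rw [hcut]
    zify at this
    push_cast
    linarith

/-- In a system whose points can be factorized over pairs of words of growing lengths, among three
points that split at `0` from other points two have the same left tail up to a shift. -/
theorem exists_ne_leftTailEq (hf : IsCoding T f) (hap : IsAperiodicCoding f)
    {w : ℕ → Bool → List A} (hw : ∀ n b, w n b ≠ [])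
    (hfac : ∀ n x, ∃ c l, IsFactorization (w n) (f x) c l)
    (hlong : ∀ K, ∃ N, ∀ n, N ≤ n → ∃ b, K ≤ (w n b).length) {x y : Fin 3 → X}
    (hxy : ∀ i, SplitsAtZero f (x i) (y i)) : ∃ i j, i ≠ j ∧ LeftTailEq f (x i) (x j) := by
  choose c l h using hfac
  choose q hq using fun n => exists_isDelay (hap.not_commute (hw n) (h n (x 0)))
  choose k hk using fun n i =>
    hf.exists_cut_eq_neg hap (hw n) (hq n) (h n (x i)) (h n (y i)) (hxy i)
  have hprefix : ∀ n i j (t : ℤ), t < 0 → -(q n : ℤ) ≤ t → f (x i) t = f (x j) t := by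
    intro n i j t ht htq
    have hi := (h n (x i)).read_common_prefix (hw n) (hq n) (k n i) (j := (t + q n).toNat)
      (by omega)
    have hj := (h n (x j)).read_common_prefix (hw n) (hq n) (k n j) (j := (t + q n).toNat)
      (by omega)
    rw [hi, hk, hk, show -(q n : ℤ) + ((t + q n).toNat : ℕ) = t by omega] at hj
    exact Option.some_injective _ hj
  by_cases hQ : ∃ Q, ∀ n, q n ≤ Q
  swap
  · push Not at hQ
    -- Unbounded delays: every negative position is eventually covered by the common prefix.
    refine ⟨0, 1, by decide, leftTailEq_of_forall_lt_zero fun t ht => ?_⟩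
    obtain ⟨n, hn⟩ := hQ (-t).toNat
    exact hprefix n 0 1 t ht (by omega)
  obtain ⟨Q, hQ⟩ := hQ
  by_cases hlen : ∀ K, ∃ n, ∀ b, K ≤ (w n b).length
  · by_contra! hcon
    have hcon' : ∀ i j, i ≠ j → ∃ t < 0, f (x i) t ≠ f (x j) t := fun i j hij => by
      by_contra! hall
      exact hcon i j hij (leftTailEq_of_forall_lt_zero hall)
    choose! t ht htne using hcon'
    -- The sum dominates every chosen position of disagreement, so both words reach back beyond all
    -- of them. Three points and two labels leave two points with the same block before `-q n`.
    obtain ⟨n, hn⟩ := hlen (∑ i, ∑ j, (t i j).natAbs)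
    obtain ⟨i, j, hij, hlab⟩ := Fintype.exists_ne_map_eq_of_card_lt
      (fun i => l n (x i) (k n i - 1)) (by simp)
    apply htne i j hij
    have hneg := ht i j hij
    have hle : (t i j).natAbs ≤ ∑ i, ∑ j, (t i j).natAbs :=
      (Finset.single_le_sum (f := fun j => (t i j).natAbs) (fun _ _ => Nat.zero_le _)
        (Finset.mem_univ j)).trans (Finset.single_le_sum
          (f := fun i => ∑ j, (t i j).natAbs) (fun _ _ => Nat.zero_le _) (Finset.mem_univ i))
    by_cases htq : -(q n : ℤ) ≤ t i j
    · exact hprefix n i j _ hneg htq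
    · have hb := hn (l n (x i) (k n i - 1))
      have hb' := hn (l n (x j) (k n j - 1))
      have hi := (h n (x i)).read_before (k n i) (t := (-(q n : ℤ) - t i j).toNat) (by omega)
        (by omega)
      have hj := (h n (x j)).read_before (k n j) (t := (-(q n : ℤ) - t i j).toNat) (by omega)
        (by omega)
      rw [hlab, hj, hk, hk,
        show -(q n : ℤ) - ((-(q n : ℤ) - t i j).toNat : ℕ) = t i j by omega] at hi
      exact (Option.some_injective _ hi).symm
  · push Not at hlen
    obtain ⟨K, hK⟩ := hlen
    obtain ⟨L, hL⟩ := hf.exists_recent_block hap K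
    by_contra! hcon
    -- The long word ends at positions `e`, `e'` that depend on `n` but stay in the finite interval
    -- `I`. A disagreement before each pair of positions is fixed first, and then a level is taken
    -- whose long word covers all of them.
    have hcon' : ∀ e e' : ℤ, ∃ t : ℕ, 0 < t ∧ f (x 0) (e - t) ≠ f (x 1) (e' - t) := fun e e' => by
      by_contra! hall
      refine hcon 0 1 (by decide) ⟨e' - e, e, fun t ht => ?_⟩
      have := hall (e - t).toNat (by omega)
      convert this using 2 <;> omega
    choose t ht htne using hcon'
    let I := Finset.Icc (-(Q + L : ℤ)) 0
    obtain ⟨n, hn⟩ := hlong (K + ∑ e ∈ I, ∑ e' ∈ I, t e e')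
    obtain ⟨b, hb⟩ := hn n le_rfl
    obtain ⟨a, ha⟩ := hK n
    have hba : b = !a := by
      rcases Bool.eq_or_eq_not b a with rfl | h
      · omega
      · exact h
    have hqn := hQ n
    obtain ⟨i, hi, hi1, hi2⟩ := hL (w n) (hw n) (x 0) _ _ (h n (x 0)) a ha (k n 0)
    obtain ⟨j, hj, hj1, hj2⟩ := hL (w n) (hw n) (x 1) _ _ (h n (x 1)) a ha (k n 1)
    rw [hk] at hi1 hi2 hj1 hj2
    set e := c n (x 0) i
    set e' := c n (x 1) j
    have he : e ∈ I := Finset.mem_Icc.2 ⟨by omega, by omega⟩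
    have he' : e' ∈ I := Finset.mem_Icc.2 ⟨by omega, by omega⟩
    have hle : t e e' ≤ ∑ e ∈ I, ∑ e' ∈ I, t e e' :=
      (Finset.single_le_sum (f := fun e' => t e e') (fun _ _ => Nat.zero_le _) he').trans
        (Finset.single_le_sum (f := fun e => ∑ e' ∈ I, t e e') (fun _ _ => Nat.zero_le _) he)
    have h0 := (h n (x 0)).read_before i (ht e e') (by rw [hi, ← hba]; omega)
    have h1 := (h n (x 1)).read_before j (ht e e') (by rw [hj, ← hba]; omega)
    rw [hi] at h0
    rw [hj, h0] at h1
    exact htne e e' (Option.some_injective _ h1)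

end IsCoding

end Counting

/-! ### Existence of factorizations by compactness -/

section Existence

variable {A : Type*}

theorem exists_int_sum (g : ℤ → ℤ) (a : ℤ) : ∃ c : ℤ → ℤ, c 0 = a ∧ ∀ i, c (i + 1) = c i + g i := by
  refine ⟨fun i => a + ∑ k ∈ Finset.range i.toNat, g k -
    ∑ k ∈ Finset.range (-i).toNat, g (-1 - k), by simp, fun i => ?_⟩
  dsimp only
  rcases le_or_gt 0 i with hi | hi
  · obtain ⟨n, rfl⟩ := Int.eq_ofNat_of_zero_le hi
    rw [show ((n : ℤ) + 1).toNat = n + 1 by omega, show (-((n : ℤ) + 1)).toNat = 0 by omega,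
      show (-(n : ℤ)).toNat = 0 by omega, Int.toNat_natCast, Finset.sum_range_succ]
    simp [add_assoc]
  · obtain ⟨n, rfl⟩ : ∃ n : ℕ, i = -1 - n := ⟨(-1 - i).toNat, by omega⟩
    rw [show (-1 - (n : ℤ) + 1).toNat = 0 by omega, show (-1 - (n : ℤ)).toNat = 0 by omega,
      show (-(-1 - (n : ℤ) + 1)).toNat = n by omega, show (-(-1 - (n : ℤ))).toNat = n + 1 by omega,
      Finset.sum_range_succ]
    ring

/-- A sequence of labels determines the lengths of the blocks, without reference to letters. -/
theorem isFactorization_unit {w : Bool → List A} {c : ℤ → ℤ} {l : ℤ → Bool}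
    (h : ∀ i, c (i + 1) = c i + (w (l i)).length) :
    IsFactorization (fun b => (w b).map fun _ => ()) (fun _ => ()) c l :=
  ⟨fun i => by rw [h, List.length_map], fun i j hj => by
    rw [List.length_map] at hj
    simp [hj]⟩

/-- A word that is a concatenation of the words `w b` can be cut accordingly. -/
theorem exists_cuts_of_infix {w : Bool → List A} (hw : ∀ b, w b ≠ []) (x : ℤ → A) (N : ℕ)
    {bs : List Bool} (hbs : factorAt x (-N) (2 * N + 1) <:+: bs.flatMap w) :
    ∃ (c : ℤ → ℤ) (l : ℤ → Bool), (∀ i, c (i + 1) = c i + (w (l i)).length) ∧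
      c 0 ≤ 0 ∧ 0 < c 1 ∧ ∀ i, ∀ j < (w (l i)).length, |c i + (j : ℕ)| ≤ N →
        (w (l i))[j]? = some (x (c i + (j : ℕ))) := by
  obtain ⟨p, s, hps⟩ := hbs
  -- Outside `bs` the labels are fillers: the head of `bs`, or `false` if `bs` is empty, on the
  -- left, and `false` on the right. Their blocks miss the window `[-N, N]`.
  let l : ℤ → Bool := fun i => bs.getD i.toNat false
  -- The start `-N - p.length` places the end of the prefix `p` at `-N`, where the window begins.
  obtain ⟨c, hc0, hc⟩ := exists_int_sum (fun i => (w (l i)).length) (-N - p.length)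
  have hu := isFactorization_unit hc
  have hw' : ∀ b, (w b).map (fun _ => ()) ≠ [] := fun b => by simpa using hw b
  have hmono := hu.strictMono hw'
  have hcut : ∀ i : ℕ, i ≤ bs.length → c i = c 0 + ((bs.take i).flatMap w).length := by
    intro i hi
    induction i with
    | zero => simp
    | succ i ih =>
      have hli : l i = bs[i] := by
        simp [l, List.getD_eq_getElem?_getD, List.getElem?_eq_getElem (show i < bs.length by omega)]
      push_cast
      rw [hc, ih (by omega), List.take_succ_eq_append_getElem (by omega), List.flatMap_append,
        List.length_append, hli]
      simp [add_assoc]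
  have hlen : c bs.length = N + 1 + s.length := by
    rw [hcut _ le_rfl, List.take_length, ← hps, hc0]
    simp [factorAt]
    ring
  have hread : ∀ i, ∀ j < (w (l i)).length, |c i + (j : ℕ)| ≤ N →
        (w (l i))[j]? = some (x (c i + (j : ℕ))) := by
    intro i j hj hN
    rw [abs_le] at hN
    have h1 : 0 < i + 1 := hmono.lt_iff_lt.1 (by rw [hc i]; omega)
    have h2 : i < bs.length := hmono.lt_iff_lt.1 (by omega)
    obtain ⟨k, rfl⟩ := Int.eq_ofNat_of_zero_le (show 0 ≤ i by omega)
    have hk : k < bs.length := by omega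
    have hlk : l k = bs[k] := by simp [l, List.getD_eq_getElem?_getD, hk]
    have hck := hcut k hk.le
    have hbs : bs = bs.take k ++ bs[k] :: bs.drop (k + 1) := by
      rw [List.getElem_cons_drop, List.take_append_drop]
    have e1 : (bs.flatMap w)[((bs.take k).flatMap w).length + j]? = (w (l k))[j]? := by
      conv_lhs => rw [hbs]
      rw [List.flatMap_append, List.flatMap_cons]
      rw [List.take_append_of_le_length (by simp; omega), List.take_take, min_self,
        List.getElem?_append_right (by omega), Nat.add_sub_cancel_left, ← hlk,
        List.getElem?_append_left hj]
    rw [← e1, ← hps]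
    obtain ⟨r, hr⟩ : ∃ r : ℕ, (r : ℤ) = c k + j + N := ⟨(c k + j + N).toNat, by omega⟩
    have e2 : ((bs.take k).flatMap w).length + j = p.length + r := by omega
    have hr' : r < 2 * N + 1 := by omega
    rw [e2, List.append_assoc, List.getElem?_append_right (by omega), Nat.add_sub_cancel_left,
      List.getElem?_append_left (by simpa [factorAt] using hr')]
    simp only [factorAt, List.getElem?_ofFn, hr', dite_true]
    congr 2
    omega
  -- The blocks are renumbered so that block `0` contains position `0`; this normalization bounds
  -- each cut independently of `N`.
  obtain ⟨i, j, hj, h0⟩ := hu.exists_block hw' 0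
  rw [List.length_map] at hj
  refine ⟨fun k => c (i + k), fun k => l (i + k), fun k => ?_, ?_, ?_, fun k => hread (i + k)⟩
  · change c (i + (k + 1)) = _
    rw [← add_assoc, hc]
  · simp only [add_zero]; omega
  · change 0 < c (i + 1)
    rw [hc i]; omega

/-- A sequence all of whose factors occur in concatenations of the words `w b` is itself such a
concatenation. -/
theorem exists_isFactorization {w : Bool → List A} (hw : ∀ b, w b ≠ []) (x : ℤ → A)
    (h : ∀ N : ℕ, ∃ N' ≥ N, ∃ bs : List Bool,
      factorAt x (-N') (2 * N' + 1) <:+: bs.flatMap w) : ∃ c l, IsFactorization w x c l := by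
  choose N hN bs hbs using h
  choose c l hstep h0 h1 hread using fun n => exists_cuts_of_infix hw x (N n) (hbs n)
  have hw' : ∀ b, (w b).map (fun _ => ()) ≠ [] := fun b => by simpa using hw b
  -- Each cut and label takes finitely many values, hence is constant along the ultrafilter; the
  -- constants form the limit factorization. Nonprincipality lets the windows exhaust `ℤ`.
  let U : Ultrafilter ℕ := hyperfilter ℕ
  obtain ⟨M, hM⟩ : ∃ M, ∀ b, (w b).length ≤ M :=
    ⟨max (w false).length (w true).length, by rintro (_ | _) <;> simp⟩
  have hbound : ∀ (i : ℤ) n, |c n i| ≤ (i.natAbs + 1) * M := by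
    intro i n
    have hu := isFactorization_unit (hstep n)
    have hM' : ∀ b, ((w b).map (fun _ => ())).length ≤ M := fun b => by simpa using hM b
    have h0 := h0 n
    have h1 := h1 n
    have hs := hstep n 0
    rw [zero_add] at hs
    have hMl := hM (l n 0)
    rw [abs_le, add_mul, one_mul]
    rcases le_total 0 i with hi | hi
    · have e1 := hu.cut_le_add hM' 0 i.natAbs
      have e2 := (hu.strictMono hw').monotone hi
      rw [zero_add, Int.natAbs_of_nonneg hi] at e1
      have : (0 : ℤ) ≤ i.natAbs * M := by positivity
      rw [Int.natAbs_of_nonneg hi] at this ⊢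
      constructor <;> omega
    · have e1 := hu.cut_le_add hM' i i.natAbs
      have e2 := (hu.strictMono hw').monotone hi
      rw [show i + (i.natAbs : ℤ) = 0 by omega] at e1
      have : (0 : ℤ) ≤ i.natAbs * M := by positivity
      constructor <;> omega
  have hlim : ∀ i, ∃ v : ℤ × Bool, ∀ᶠ n in (U : Filter ℕ), (c n i, l n i) = v := by
    intro i
    have hfin : (Set.Icc (-((i.natAbs + 1) * M : ℤ)) ((i.natAbs + 1) * M) ×ˢ
      (Set.univ : Set Bool)).Finite := Set.toFinite _
    obtain ⟨v, -, hv⟩ := (Ultrafilter.eventually_exists_mem_iff (f := U)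
      (P := fun v n => (c n i, l n i) = v) hfin).1 <| Eventually.of_forall fun n =>
        ⟨_, ⟨abs_le.1 (hbound i n), trivial⟩, rfl⟩
    exact ⟨v, hv⟩
  choose v hv using hlim
  refine ⟨fun i => (v i).1, fun i => (v i).2, fun i => ?_, fun i j hj => ?_⟩
  · obtain ⟨n, e1, e2⟩ := ((hv i).and (hv (i + 1))).exists
    simp only [← e1, ← e2]
    exact hstep n i
  · have hlarge : ∀ᶠ n in (U : Filter ℕ), ((v i).1 + (j : ℤ)).natAbs ≤ n :=
      (eventually_ge_atTop _).filter_mono Nat.hyperfilter_le_atTop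
    obtain ⟨n, e1, e2⟩ := ((hv i).and hlarge).exists
    have h3 := hread n i j
    rw [← e1] at e2 hj ⊢
    refine h3 hj ?_
    rw [Int.abs_eq_natAbs]
    exact_mod_cast e2.trans (hN n)

end Existence

/-! ### Part 1: `S`-adic subshifts on two letters -/

section SadicComponents

theorem IsCoding.isAperiodicCoding {X A : Type*} [TopologicalSpace X] {T : X ≃ₜ X}
    {f : X → ℤ → A} (hf : IsCoding T f) (hinj : Function.Injective f)
    (hT : IsAperiodicSystem T) : IsAperiodicCoding f := by
  intro x p hp
  by_contra! hcon
  have hfix : (T ^ (p : ℤ)) x = x := hinj (funext fun t => by rw [hf.apply_zpow, ← hcon t])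
  have hmul : ∀ k : ℤ, ((T ^ (p : ℤ)) ^ k) x = x := fun k => by
    induction k using Int.induction_on with
    | zero => rfl
    | succ k ih => rw [zpow_add_one, Homeomorph.mul_apply, hfix, ih]
    | pred k ih =>
      rw [zpow_sub_one, Homeomorph.mul_apply, Homeomorph.inv_apply]
      rwa [(Homeomorph.symm_apply_eq _).2 hfix.symm]
  refine hT x (((Set.finite_Ico (0 : ℤ) p).image fun n => (T ^ n) x).subset ?_)
  rintro _ ⟨n, rfl⟩
  refine ⟨n % p, ⟨Int.emod_nonneg _ (by omega), Int.emod_lt_of_pos _ (by omega)⟩, ?_⟩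
  conv_rhs => rw [← Int.emod_add_mul_ediv n p]
  dsimp only
  rw [zpow_add, zpow_mul, Homeomorph.mul_apply, hmul]

variable {A : Type*}

theorem blockImage_append (τ : ℕ → A → List A) (n k : ℕ) (u v : List A) :
    blockImage τ n k (u ++ v) = blockImage τ n k u ++ blockImage τ n k v := by
  induction k generalizing u v with
  | zero => rfl
  | succ k ih => simp only [blockImage, List.flatMap_append, ih]

theorem blockImage_add (τ : ℕ → A → List A) (n k m : ℕ) (u : List A) :
    blockImage τ n (k + m) u = blockImage τ n k (blockImage τ (n + k) m u) := by
  induction m generalizing u with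
  | zero => rfl
  | succ m ih => rw [← add_assoc, blockImage, ih, blockImage, add_assoc]

theorem blockImage_nil (τ : ℕ → A → List A) (n k : ℕ) : blockImage τ n k [] = [] := by
  induction k with
  | zero => rfl
  | succ k ih => exact ih

theorem blockImage_eq_flatMap (τ : ℕ → A → List A) (n k : ℕ) (u : List A) :
    blockImage τ n k u = u.flatMap fun a => blockImage τ n k [a] := by
  induction u with
  | nil => exact blockImage_nil τ n k
  | cons a u ih => rw [← List.singleton_append, blockImage_append, ih]; simp

theorem length_le_length_blockImage {τ : ℕ → A → List A} (hτ : ∀ n a, τ n a ≠ []) (n k : ℕ)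
    (u : List A) : u.length ≤ (blockImage τ n k u).length := by
  induction k generalizing u with
  | zero => rfl
  | succ k ih =>
    refine le_trans ?_ (ih _)
    rw [List.length_flatMap]
    induction u with
    | nil => simp
    | cons a u ihu =>
      have := List.length_pos_iff.2 (hτ (n + k) a)
      simp
      omega

theorem blockImage_ne_nil {τ : ℕ → A → List A} (hτ : ∀ n a, τ n a ≠ []) (n k : ℕ) (a : A) :
    blockImage τ n k [a] ≠ [] := by
  have := length_le_length_blockImage hτ n k [a]
  exact List.length_pos_iff.1 this

section TwoLetters

variable {τ : ℕ → A → List A}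

/-- The larger of the two lengths never decreases with the level. If it did, the longer letter would
occur in neither image, so both images would be powers of the other letter, and the words of the
next level would commute. -/
theorem exists_length_le_blockImage (e : Bool ≃ A) {x : ℤ → A}
    (hx : x ∈ sadicSubshift τ)
    (hc : ∀ n, blockImage τ 0 n [e false] ++ blockImage τ 0 n [e true] ≠
      blockImage τ 0 n [e true] ++ blockImage τ 0 n [e false]) (K : ℕ) :
    ∃ N, ∀ n, N ≤ n → ∃ b, K ≤ (blockImage τ 0 n [e b]).length := by
  have hstep : ∀ n b, ∃ b', (blockImage τ 0 n [e b]).length ≤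
      (blockImage τ 0 (n + 1) [e b']).length := by
    intro n b
    by_contra! hcon
    have hone : ∀ a, blockImage τ 0 (n + 1) [a] = blockImage τ 0 n (τ n a) := fun a => by
      simp [blockImage]
    have hrep : ∀ b', τ n (e b') = List.replicate (τ n (e b')).length (e !b) := by
      intro b'
      refine List.eq_replicate_of_mem fun a ha => ?_
      obtain ⟨d, rfl⟩ := e.surjective a
      refine congrArg e ((Bool.eq_or_eq_not d b).resolve_left fun hd => ?_)
      subst hd
      have h1 := hcon b'
      obtain ⟨u, v, huv⟩ := List.append_of_mem ha
      rw [hone, huv, ← List.singleton_append, blockImage_append, blockImage_append,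
        List.length_append, List.length_append] at h1
      omega
    apply hc (n + 1)
    rw [hone, hone, ← blockImage_append, ← blockImage_append, hrep false, hrep true,
      List.replicate_append_replicate, List.replicate_append_replicate, add_comm]
  obtain ⟨M, hM, a, ha⟩ := hx 0 K
  refine ⟨M, fun n hn => ?_⟩
  induction n, hn using Nat.le_induction with
  | base =>
    refine ⟨e.symm a, ?_⟩
    have := ha.length_le
    simpa [factorAt] using this
  | succ n hn ih =>
    obtain ⟨b, hb⟩ := ih
    obtain ⟨b', hb'⟩ := hstep n b
    exact ⟨b', hb.trans hb'⟩

/-- Long factors of a point of the subshift occur in images of high order. -/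
theorem exists_level_of_mem_sadicSubshift [Fintype A] {x : ℤ → A}
    (hx : x ∈ sadicSubshift τ) (n N : ℕ) :
    ∃ N' ≥ N, ∃ m a, factorAt x (-N') (2 * N' + 1) <:+: blockImage τ 0 (n + m) [a] := by
  -- A factor longer than all images of order below `n` can only come from order at least `n`.
  let K := ∑ M ∈ Finset.range n, ∑ a : A, (blockImage τ 0 M [a]).length
  obtain ⟨M, hM, a, ha⟩ := hx (-(N + K : ℕ)) (2 * (N + K) + 1)
  rw [Nat.sub_zero] at ha
  refine ⟨N + K, by omega, ?_⟩
  by_cases hMn : M < n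
  · exfalso
    have h1 := ha.length_le
    have h2 : (blockImage τ 0 M [a]).length ≤ K :=
      (Finset.single_le_sum (f := fun a => (blockImage τ 0 M [a]).length)
        (fun _ _ => Nat.zero_le _) (Finset.mem_univ a)).trans
      (Finset.single_le_sum (f := fun M => ∑ a : A, (blockImage τ 0 M [a]).length)
        (fun _ _ => Nat.zero_le _) (Finset.mem_range.2 hMn))
    simp only [factorAt, List.length_ofFn] at h1
    omega
  · obtain ⟨m, rfl⟩ := Nat.exists_eq_add_of_le (not_lt.1 hMn)
    exact ⟨m, a, ha⟩

theorem exists_isFactorization_of_mem_sadicSubshift [Fintype A] (hτ : ∀ n a, τ n a ≠ []) (e : Bool ≃ A)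
    {x : ℤ → A} (hx : x ∈ sadicSubshift τ) (n : ℕ) :
    ∃ c l, IsFactorization (fun b => blockImage τ 0 n [e b]) x c l := by
  refine exists_isFactorization (fun b => blockImage_ne_nil hτ 0 n (e b)) x fun N => ?_
  obtain ⟨N', hN', m, a, h⟩ := exists_level_of_mem_sadicSubshift hx n N
  refine ⟨N', hN', (blockImage τ (0 + n) m [a]).map e.symm, ?_⟩
  rw [List.flatMap_map]
  simp only [Equiv.apply_symm_apply]
  rwa [← blockImage_eq_flatMap, ← blockImage_add]

end TwoLetters

theorem isClosed_sadicSubshift [TopologicalSpace A] [DiscreteTopology A]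
    (τ : ℕ → A → List A) : IsClosed (sadicSubshift τ) := by
  have : sadicSubshift τ = ⋂ m : ℤ, ⋂ ℓ : ℕ,
      (fun (x : ℤ → A) (i : Fin ℓ) => x (m + (i : ℕ))) ⁻¹'
        {v | List.ofFn v ∈ levelLanguage τ 0} := by
    ext x
    simp only [Set.mem_iInter]
    rfl
  rw [this]
  exact isClosed_iInter fun m => isClosed_iInter fun ℓ =>
    (isClosed_discrete _).preimage (by fun_prop)

theorem isCoding_sadicShift [TopologicalSpace A] [DiscreteTopology A] (τ : ℕ → A → List A) :
    IsCoding (sadicShift τ) (Subtype.val : sadicSubshift τ → ℤ → A) :=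
  ⟨fun t => (IsLocallyConstant.iff_continuous _).2
    ((continuous_apply t).comp continuous_subtype_val), fun _ _ => rfl⟩

/-- A two-letter `S`-adic subshift has at most two asymptotic components. -/
theorem encard_asymptoticComponents_sadicShift_le [Fintype A] [UniformSpace A]
    [DiscreteUniformity A] (hA : Fintype.card A = 2) (τ : ℕ → A → List A)
    (hτ : ∀ n a, τ n a ≠ []) (hap : IsAperiodicSystem (sadicShift τ)) :
    (asymptoticComponents (sadicShift τ)).encard ≤ 2 := by
  have hf := isCoding_sadicShift τ
  have hinj : Function.Injective (Subtype.val : sadicSubshift τ → ℤ → A) :=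
    Subtype.val_injective
  have hapc := hf.isAperiodicCoding hinj hap
  have : CompactSpace (sadicSubshift τ) :=
    isCompact_iff_compactSpace.1 (isClosed_sadicSubshift τ).isCompact
  let e : Bool ≃ A := Fintype.equivOfCardEq (by rw [hA]; rfl)
  -- A third component would give three splitting points, two of which have the same left tail and
  -- hence the same class.
  by_contra! hlt
  obtain ⟨S, hS, hcard⟩ := Set.exists_subset_encard_eq (Order.add_one_le_of_lt hlt)
  obtain ⟨C₁, C₂, C₃, h12, h13, h23, rfl⟩ := Set.encard_eq_three.1
    (hcard.trans (by norm_num))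
  let C : Fin 3 → Set (Set (sadicSubshift τ)) := ![C₁, C₂, C₃]
  have hCinj : ∀ i j, C i = C j → i = j := by
    intro i j
    fin_cases i <;> fin_cases j <;> simp [C, h12, h13, h23, h12.symm, h13.symm, h23.symm]
  have hC : ∀ i, C i ∈ asymptoticComponents (sadicShift τ) := by
    intro i
    apply hS
    fin_cases i <;> simp [C]
  choose x y hxy hCx using fun i => hf.exists_splitsAtZero_of_mem hinj (hC i)
  have hne := fun n b => blockImage_ne_nil hτ 0 n (e b)
  have hfac := fun n (x : sadicSubshift τ) =>
    exists_isFactorization_of_mem_sadicSubshift hτ e x.2 n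
  obtain ⟨i, j, hij, htail⟩ := hf.exists_ne_leftTailEq hapc
    (w := fun n b => blockImage τ 0 n [e b]) hne hfac
    (exists_length_le_blockImage e (x 0).2 fun n => by
      obtain ⟨c, l, h⟩ := hfac n (x 0)
      exact hapc.not_commute (hne n) h) hxy
  apply hij
  apply hCinj
  rw [hCx i, hCx j]
  exact hf.asymptoticClass_eq hinj htail

end SadicComponents

/-! ### Odometers have one vertex on each level -/

section Odometer

/-- The diagram with one vertex on each level and `q n` edges from level `n` to level `n + 1`. -/
def odometerDiagram (q : ℕ → ℕ) (hq : ∀ n, 0 < q n) : OrderedBratteliDiagram where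
  V _ := Unit
  E n := Fin (q n)
  finite_V _ := inferInstance
  finite_E _ := inferInstance
  unique_V_zero := ⟨inferInstance⟩
  source _ := ()
  range _ := ()
  source_surjective n := fun _ => ⟨⟨0, hq n⟩, rfl⟩
  range_surjective n := fun _ => ⟨⟨0, hq n⟩, rfl⟩
  order _ := inferInstance
  comparable_iff e f := ⟨fun _ => rfl, fun _ => le_total (α := Fin _) e f⟩

variable {q : ℕ → ℕ} {hq : ∀ n, 0 < q n}

theorem odometerDiagram_isMax_iff {n : ℕ} {e : Fin (q n)} :
    IsMax (α := (odometerDiagram q hq).E n) e ↔ e.val + 1 = q n := by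
  constructor
  · intro h
    have hn := hq n
    have h1 : (⟨q n - 1, by omega⟩ : Fin (q n)) ≤ e :=
      h (b := (⟨q n - 1, by omega⟩ : Fin (q n))) (show e.val ≤ q n - 1 by omega)
    have h2 : q n - 1 ≤ e.val := h1
    omega
  · intro h f _
    have hf := Fin.isLt (show Fin (q n) from f)
    exact show (show Fin (q n) from f).val ≤ e.val by omega

theorem odometerDiagram_isMin_iff {n : ℕ} {e : Fin (q n)} :
    IsMin (α := (odometerDiagram q hq).E n) e ↔ e.val = 0 := by
  constructor
  · intro h
    have h1 : e ≤ (⟨0, hq n⟩ : Fin (q n)) :=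
      h (b := (⟨0, hq n⟩ : Fin (q n))) (Nat.zero_le _)
    exact Nat.le_zero.1 h1
  · intro h f _
    exact show e.val ≤ (show Fin (q n) from f).val by omega

theorem odometerDiagram_isProperlyOrdered : (odometerDiagram q hq).IsProperlyOrdered := by
  refine ⟨⟨⟨fun n => (⟨q n - 1, by have := hq n; omega⟩ : Fin (q n)), fun _ => rfl⟩, fun n => ?_,
    fun y hy => Subtype.ext (funext fun n => ?_)⟩,
    ⟨fun n => (⟨0, hq n⟩ : Fin (q n)), fun _ => rfl⟩, fun n => ?_,
    fun y hy => Subtype.ext (funext fun n => ?_)⟩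
  · exact odometerDiagram_isMax_iff.2 (by have := hq n; simp; omega)
  · have := odometerDiagram_isMax_iff.1 (hy n)
    exact Fin.ext (by simp; omega)
  · exact odometerDiagram_isMin_iff.2 rfl
  · exact Fin.ext (odometerDiagram_isMin_iff.1 (hy n))

theorem odometerDiagram_isSimple : (odometerDiagram q hq).IsSimple := fun n _ =>
  ⟨n + 1, n.lt_succ_self, fun u _ =>
    OrderedBratteliDiagram.Joined.step (B := odometerDiagram q hq) (u := u)
      (⟨0, hq n⟩ : Fin (q n)) (OrderedBratteliDiagram.Joined.refl u)⟩

/-- A system with compatible factors onto the rotations of `ℤ / h n`, which separate points, has a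
representation with one vertex on each level. -/
theorem exists_represents_of_cyclic_factors {X : Type*} [TopologicalSpace X] [CompactSpace X]
    (T : X ≃ₜ X) (h : ℕ → ℕ) (I : ℕ → X → ℕ) (h0 : h 0 = 1) (hpos : ∀ n, 0 < h n)
    (hdvd : ∀ n, h n ∣ h (n + 1)) (hlt : ∀ n x, I n x < h n)
    (hcomp : ∀ n x, I n x = I (n + 1) x % h n) (hT : ∀ n x, I n (T x) = (I n x + 1) % h n)
    (hloc : ∀ n, IsLocallyConstant (I n)) (hsep : ∀ x y, (∀ n, I n x = I n y) → x = y)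
    (hsurj : ∀ n, ∀ t < h n, ∃ x, I n x = t) :
    ∃ B : OrderedBratteliDiagram, B.Represents T ∧ ∀ n, Nat.card (B.V n) ≤ 1 := by
  choose q hq using hdvd
  have hqpos : ∀ n, 0 < q n := fun n => Nat.pos_of_ne_zero fun hz => by
    have := hq n
    rw [hz, mul_zero] at this
    exact (hpos (n + 1)).ne' this
  -- The path of `x` consists of the mixed-radix digits of its residues `I n x`; on these, `T` adds
  -- one with carry.
  let d : ℕ → X → ℕ := fun n x => I (n + 1) x / h n
  have hd : ∀ n x, d n x < q n := fun n x =>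
    Nat.div_lt_of_lt_mul ((hlt (n + 1) x).trans_eq (hq n))
  have hId : ∀ n x, I (n + 1) x = I n x + h n * d n x := fun n x => by
    rw [hcomp n x]
    exact (Nat.mod_add_div _ _).symm
  have hdeq : ∀ {n x i a}, I (n + 1) x = i + h n * a → i < h n → d n x = a := fun {n x i a} e hi => by
    simp only [d]
    rw [e, Nat.add_mul_div_left _ _ (hpos n), Nat.div_eq_of_lt hi, zero_add]
  have hI0 : ∀ x, I 0 x = 0 := fun x => by have := hlt 0 x; omega
  let φ : X → (odometerDiagram q hqpos).PathSpace :=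
    fun x => ⟨fun n => (⟨d n x, hd n x⟩ : Fin (q n)), fun _ => rfl⟩
  have hIeq : ∀ x y, (∀ n, d n x = d n y) → ∀ n, I n x = I n y := by
    intro x y hxy n
    induction n with
    | zero => rw [hI0, hI0]
    | succ n ih => rw [hId, hId, ih, hxy]
  have hdloc : ∀ n, IsLocallyConstant (d n) := fun n => (hloc (n + 1)).comp (· / h n)
  have hφc : Continuous φ := by
    refine Continuous.subtype_mk (continuous_pi fun n => ?_) _
    refine IsLocallyConstant.continuous ((IsLocallyConstant.iff_eventually_eq _).2 fun x => ?_)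
    filter_upwards [(hdloc n).eventually_eq x] with y hy
    exact Fin.ext hy
  have hφi : Function.Injective φ := by
    intro x y hxy
    refine hsep x y (hIeq x y fun n => ?_)
    exact congrArg Fin.val (congrFun (congrArg Subtype.val hxy) n)
  have hφs : Function.Surjective φ := by
    intro a
    let a' : ℕ → ℕ := fun n => (show Fin (q n) from a.1 n).val
    have ha' : ∀ n, a' n < q n := fun n => (show Fin (q n) from a.1 n).isLt
    have hex : ∀ n, ∃ x, ∀ m < n, d m x = a' m := by
      have hex' : ∀ n, ∃ t < h n, ∀ x, I n x = t → ∀ m < n, d m x = a' m := by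
        intro n
        induction n with
        | zero => exact ⟨0, hpos 0, fun x _ m hm => absurd hm (Nat.not_lt_zero m)⟩
        | succ n ih =>
          obtain ⟨t, ht, htd⟩ := ih
          refine ⟨t + h n * a' n, ?_, fun x hx m hm => ?_⟩
          · rw [hq n]
            calc t + h n * a' n < h n * (a' n + 1) := by rw [mul_add, mul_one]; omega
              _ ≤ h n * q n := Nat.mul_le_mul_left _ (ha' n)
          · rcases Nat.lt_succ_iff_lt_or_eq.1 hm with hm' | rfl
            · refine htd x ?_ m hm'
              rw [hcomp, hx, Nat.add_mul_mod_self_left, Nat.mod_eq_of_lt ht]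
            · exact hdeq hx ht
      intro n
      obtain ⟨t, ht, htd⟩ := hex' n
      obtain ⟨x, hx⟩ := hsurj n t ht
      exact ⟨x, htd x hx⟩
    -- Every finite string of digits is realized, so compactness yields a point with all the
    -- prescribed digits.
    by_contra! hcon
    obtain ⟨n, hn⟩ := exists_forall_notMem_of_antitone
      (F := fun n : ℕ => ⋂ m ∈ {m | m < n}, {x | d m x = a' m})
      (fun n m hnm => Set.biInter_subset_biInter_left fun s (hs : s < n) => hs.trans_le hnm)
      (fun n => isClosed_biInter fun m _ => (hdloc m).isClosed_fiber _)
      (fun x => by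
        by_contra! hmem
        refine hcon x (Subtype.ext (funext fun n => Fin.ext ?_))
        exact Set.mem_iInter₂.1 (hmem (n + 1)) n n.lt_succ_self)
    obtain ⟨x, hx⟩ := hex n
    exact hn x (Set.mem_iInter₂.2 hx)
  let Φ : X ≃ₜ (odometerDiagram q hqpos).PathSpace :=
    Continuous.homeoOfEquivCompactToT2 (f := Equiv.ofBijective φ ⟨hφi, hφs⟩) hφc
  refine ⟨odometerDiagram q hqpos, ⟨odometerDiagram_isSimple, odometerDiagram_isProperlyOrdered, Φ,
    fun x => ?_⟩, fun n => ?_⟩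
  · refine (OrderedBratteliDiagram.existsUnique_vershikRel odometerDiagram_isProperlyOrdered
      (φ x)).unique ?_ (OrderedBratteliDiagram.existsUnique_vershikRel
        odometerDiagram_isProperlyOrdered (φ x)).choose_spec.1
    -- If all digits below `n` are maximal, then `I n x = h n - 1`, and adding one carries past
    -- them.
    have hcarry : ∀ n, (∀ m < n, d m x + 1 = q m) → I n x + 1 = h n := by
      intro n hn
      induction n with
      | zero => rw [hI0, h0]
      | succ n ih =>
        rw [hq n, ← hn n n.lt_succ_self, hId, mul_add, mul_one, ← ih fun m hm => hn m (by omega)]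
        ring
    have hzero : ∀ n, I n x + 1 = h n → I n (T x) = 0 := fun n hn => by
      rw [hT, hn, Nat.mod_self]
    have hdzero : ∀ n, (∀ m < n + 1, d m x + 1 = q m) → d n (T x) = 0 := fun n hn => by
      simp only [d]
      rw [hzero _ (hcarry _ hn), Nat.zero_div]
    refine ⟨fun hmax n => odometerDiagram_isMin_iff.2 (hdzero n fun m _ =>
      odometerDiagram_isMax_iff.1 (hmax m)), fun n hmax hn => ?_⟩
    have hmax' : ∀ m < n, d m x + 1 = q m := fun m hm => odometerDiagram_isMax_iff.1 (hmax m hm)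
    have hn' : d n x + 1 < q n := by
      have h1 := hd n x
      have h2 : d n x + 1 ≠ q n := fun he => hn (odometerDiagram_isMax_iff.2 he)
      omega
    have hc := hcarry n hmax'
    have hnext : ∀ m, n < m → I m x + 1 < h m := by
      intro m hm
      induction m, Nat.succ_le_of_lt hm using Nat.le_induction with
      | base =>
        rw [hId, hq n]
        calc I n x + h n * d n x + 1 = h n * (d n x + 1) := by rw [← hc]; ring
          _ < h n * q n := Nat.mul_lt_mul_of_pos_left hn' (hpos n)
      | succ m hm' ih =>
        have ih := ih hm'
        rw [hId, hq m]
        calc I m x + h m * d m x + 1 < h m * (d m x + 1) := by rw [mul_add, mul_one]; omega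
          _ ≤ h m * q m := Nat.mul_le_mul_left _ (hd m x)
    have hTn : ∀ m, n < m → I m (T x) = I m x + 1 := fun m hm => by
      rw [hT, Nat.mod_eq_of_lt (hnext m hm)]
    refine ⟨fun m hm => odometerDiagram_isMin_iff.2 (hdzero m fun k hk => hmax' k (by omega)), ?_,
      fun m hm => Fin.ext ?_⟩
    · have hdn : d n (T x) = d n x + 1 := by
        refine hdeq (i := 0) ?_ (hpos n)
        rw [hTn _ n.lt_succ_self, hId, ← hc]
        ring
      have hcov : (⟨d n x, hd n x⟩ : Fin (q n)) ⋖ ⟨d n (T x), hd n (T x)⟩ := by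
        refine ⟨?_, fun e h1 h2 => ?_⟩
        · change d n x < d n (T x)
          omega
        · have h1' : d n x < e.val := h1
          have h2' : e.val < d n (T x) := h2
          omega
      exact hcov
    · change d m (T x) = d m x
      refine hdeq (i := I m x + 1) ?_ (hnext m hm)
      rw [hTn _ (by omega), hId]
      ring
  · change Nat.card Unit ≤ 1
    simp

end Odometer

/-! ### Periodic codings of minimal systems are cyclic factors -/

section PeriodicCodings

theorem IsCoding.congr_zpow {X A : Type*} [TopologicalSpace X] {T : X ≃ₜ X} {f : X → ℤ → A}
    (hf : IsCoding T f) {x y : X} (h : f x = f y) (n : ℤ) : f ((T ^ n) x) = f ((T ^ n) y) := by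
  funext t
  rw [hf.apply_zpow, hf.apply_zpow, h]

/-- In a minimal system, a return of one coded point is a period of all of them. -/
theorem IsCoding.period_of_period {X A : Type*} [TopologicalSpace X] {T : X ≃ₜ X}
    (hT : IsMinimalSystem T) {f : X → ℤ → A} (hf : IsCoding T f) {x : X} {n : ℤ}
    (h : f ((T ^ n) x) = f x) (y : X) : f ((T ^ n) y) = f y := by
  funext s
  have hcl : IsClosed {z | f z (s + n) = f z s} := (hf.isClopen_agree _ _).isClosed
  have hsub : orbitOf T x ⊆ {z | f z (s + n) = f z s} := by
    rintro _ ⟨m, rfl⟩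
    have := congrFun h (s + m)
    rw [hf.apply_zpow] at this
    change f ((T ^ m) x) (s + n) = f ((T ^ m) x) s
    rw [hf.apply_zpow, hf.apply_zpow, ← this]
    congr 1; ring
  rw [hf.apply_zpow]
  exact hcl.closure_subset_iff.2 hsub (hT x y)

/-- A periodic coding of a minimal system is a factor map onto a rotation of `ℤ / h`. -/
theorem IsCoding.exists_cyclic_factor {X A : Type*} [TopologicalSpace X] {T : X ≃ₜ X}
    (hT : IsMinimalSystem T) {f : X → ℤ → A} (hf : IsCoding T f) (x₀ : X)
    (hper : ¬ IsAperiodicCoding f) : ∃ (h : ℕ) (I : X → ℕ), 0 < h ∧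
      (∀ x, ∀ n : ℤ, f ((T ^ n) x) = f x ↔ (h : ℤ) ∣ n) ∧ (∀ x, I x < h) ∧
      ∀ x, f x = f ((T ^ (I x : ℤ)) x₀) := by
  classical
  have hex : ∃ p : ℕ, 0 < p ∧ f ((T ^ (p : ℤ)) x₀) = f x₀ := by
    unfold IsAperiodicCoding at hper
    push Not at hper
    obtain ⟨x, p, hp, h⟩ := hper
    exact ⟨p, hp, hf.period_of_period hT
      (x := x) (funext fun t => by rw [hf.apply_zpow, ← h t]) x₀⟩
  obtain ⟨hpos, hh⟩ := Nat.find_spec hex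
  set h := Nat.find hex with hdef
  have hmul : ∀ (k : ℤ) x, f ((T ^ ((h : ℤ) * k)) x) = f x := by
    intro k
    induction k using Int.induction_on with
    | zero => intro x; simp
    | succ k ih =>
      intro x
      rw [mul_add, mul_one, zpow_add, Homeomorph.mul_apply, ih, hf.period_of_period hT hh]
    | pred k ih =>
      intro x
      have h1 := hf.period_of_period hT hh ((T ^ ((h : ℤ) * (-k - 1))) x)
      rw [← Homeomorph.mul_apply, ← zpow_add,
        show (h : ℤ) + h * (-k - 1) = h * -k by ring, ih] at h1
      exact h1.symm
  have hmod : ∀ (n : ℤ) x, f ((T ^ n) x) = f ((T ^ (n % h)) x) := fun n x => by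
    conv_lhs => rw [← Int.emod_add_mul_ediv n h, add_comm, zpow_add, Homeomorph.mul_apply]
    rw [hmul]
  have hiff : ∀ x, ∀ n : ℤ, f ((T ^ n) x) = f x ↔ (h : ℤ) ∣ n := by
    intro x n
    constructor
    · intro hn
      by_contra hnd
      have h1 : n % h ≠ 0 := fun h0 => hnd (Int.dvd_of_emod_eq_zero h0)
      have h2 := Int.emod_nonneg n (show (h : ℤ) ≠ 0 by omega)
      have h3 := Int.emod_lt_of_pos n (show (0 : ℤ) < h by omega)
      refine Nat.find_min hex (m := (n % h).toNat) (by omega) ⟨by omega, ?_⟩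
      rw [Int.toNat_of_nonneg h2, ← hmod]
      exact hf.period_of_period hT hn x₀
    · rintro ⟨k, rfl⟩
      exact hmul k x
  have hI : ∀ x, ∃ i < h, f x = f ((T ^ (i : ℤ)) x₀) := by
    intro x
    -- By periodicity `h` consecutive letters determine the coding, so its fibre is open and is met
    -- by the orbit of `x₀`.
    have hopen : IsOpen (⋂ s ∈ Finset.range h, {y | f y (s : ℕ) = f x (s : ℕ)}) :=
      isOpen_biInter_finset fun s _ => (hf.locallyConstant s).isOpen_fiber _
    obtain ⟨_, ⟨n, rfl⟩, hy⟩ := (hT x₀).exists_mem_open hopen ⟨x, by simp⟩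
    have heq : f x = f ((T ^ n) x₀) := by
      funext t
      have e : ∀ y, f y t = f y (t % h) := fun y => by
        have := congrFun (hmod t y) 0
        rwa [hf.apply_zpow, hf.apply_zpow, zero_add, zero_add] at this
      have h2 := Int.emod_nonneg t (show (h : ℤ) ≠ 0 by omega)
      have h3 := Int.emod_lt_of_pos t (show (0 : ℤ) < h by omega)
      have := Set.mem_iInter₂.1 hy (t % h).toNat (Finset.mem_range.2 (by omega))
      rw [Set.mem_ofPred_eq, Int.toNat_of_nonneg h2] at this
      rw [e, e ((T ^ n) x₀)]
      exact this.symm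
    have h2 := Int.emod_nonneg n (show (h : ℤ) ≠ 0 by omega)
    have h3 := Int.emod_lt_of_pos n (show (0 : ℤ) < h by omega)
    refine ⟨(n % h).toNat, by omega, ?_⟩
    rw [Int.toNat_of_nonneg h2, ← hmod, heq]
  choose I hIlt hI using hI
  exact ⟨h, I, hpos, hiff, hIlt, hI⟩

/-- A minimal system with a separating sequence of periodic codings, each a function of the next
one, has a representation with one vertex on each level. -/
theorem exists_represents_of_periodic_codings {X : Type*} [TopologicalSpace X] [CompactSpace X]
    [Nonempty X] {T : X ≃ₜ X} (hT : IsMinimalSystem T) {A : ℕ → Type*}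
    (f : ∀ n, X → ℤ → A n) (hf : ∀ n, IsCoding T (f n)) (hzero : ∀ x y, f 0 x = f 0 y)
    (hmono : ∀ n x y, f (n + 1) x = f (n + 1) y → f n x = f n y)
    (hsep : ∀ x y, (∀ n, f n x = f n y) → x = y) (hper : ∀ n, ¬ IsAperiodicCoding (f n)) :
    ∃ B : OrderedBratteliDiagram, B.Represents T ∧ ∀ n, Nat.card (B.V n) ≤ 1 := by
  obtain ⟨x₀⟩ := ‹Nonempty X›
  choose h I hpos hiff hlt hI using fun n => (hf n).exists_cyclic_factor hT x₀ (hper n)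
  have huniq : ∀ n x, ∀ t : ℕ, f n x = f n ((T ^ (t : ℤ)) x₀) → I n x = t % h n := by
    intro n x t ht
    rw [hI n x] at ht
    have h1 : f n ((T ^ ((t : ℤ) - I n x)) ((T ^ (I n x : ℤ)) x₀)) =
        f n ((T ^ (I n x : ℤ)) x₀) := by
      rw [← Homeomorph.mul_apply, ← zpow_add, sub_add_cancel, ht]
    have h2 := (hiff n _ _).1 h1
    have h3 : I n x ≡ t [MOD h n] := (Nat.modEq_iff_dvd).2 h2
    rw [← h3, Nat.mod_eq_of_lt (hlt n x)]
  refine exists_represents_of_cyclic_factors T h I ?_ hpos ?_ hlt ?_ ?_ ?_ ?_ ?_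
  · have := (hiff 0 x₀ 1).1 (hzero _ _)
    exact_mod_cast Int.eq_one_of_dvd_one (by positivity) this
  · intro n
    have h1 := (hiff (n + 1) x₀ (h (n + 1))).2 dvd_rfl
    exact_mod_cast (hiff n x₀ _).1 (hmono n _ _ h1)
  · exact fun n x => huniq n x _ (hmono n _ _ (hI (n + 1) x))
  · intro n x
    refine huniq n (T x) _ ?_
    have := (hf n).congr_zpow (hI n x) 1
    rw [← Homeomorph.mul_apply, ← zpow_add, add_comm, zpow_one] at this
    rw [this]
    norm_num
  · intro n
    refine (IsLocallyConstant.iff_eventually_eq _).2 fun x => ?_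
    have hopen : IsOpen (⋂ s ∈ Finset.range (h n), {y | f n y (s : ℕ) = f n x (s : ℕ)}) :=
      isOpen_biInter_finset fun s _ => ((hf n).locallyConstant s).isOpen_fiber _
    filter_upwards [hopen.mem_nhds (show x ∈ _ by simp)] with y hy
    have heq : f n y = f n x := by
      funext t
      have hp := hpos n
      have h2 := Int.emod_nonneg t (show (h n : ℤ) ≠ 0 by omega)
      have h3 := Int.emod_lt_of_pos t (show (0 : ℤ) < h n by omega)
      have e : ∀ y, f n y t = f n y (t % h n) := fun y => by
        have := congrFun ((hiff n y (t - t % h n)).2 (Int.dvd_self_sub_emod)) (t % h n)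
        rw [(hf n).apply_zpow, add_sub_cancel] at this
        exact this
      have := Set.mem_iInter₂.1 hy (t % h n).toNat (Finset.mem_range.2 (by omega))
      rw [Set.mem_ofPred_eq, Int.toNat_of_nonneg h2] at this
      rw [e, e x]
      exact this
    rw [huniq n y _ (heq.trans (hI n x)), Nat.mod_eq_of_lt (hlt n x)]
  · intro x y hxy
    exact hsep x y fun n => by rw [hI n x, hI n y, hxy n]
  · intro n t ht
    exact ⟨(T ^ (t : ℤ)) x₀, by rw [huniq n _ t rfl, Nat.mod_eq_of_lt ht]⟩

end PeriodicCodings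

/-! ### Part 2: Bratteli–Vershik systems of rank two -/

section Bratteli

theorem IsFactorization.map {A A' : Type*} {w : Bool → List A} {z : ℤ → A} {c : ℤ → ℤ}
    {l : ℤ → Bool} (h : IsFactorization w z c l) (g : A → A') :
    IsFactorization (fun b => (w b).map g) (fun t => g (z t)) c l :=
  ⟨fun i => by rw [List.length_map, h.step], fun i j hj => by
    rw [List.length_map] at hj
    rw [List.getElem?_map, h.read i j hj, Option.map_some]⟩

/-- A set of integers that is unbounded in both directions can be enumerated increasingly. -/
theorem exists_enumeration {K : Set ℤ} (hup : ∀ t, ∃ s ∈ K, t < s) (hdn : ∀ t, ∃ s ∈ K, s < t) :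
    ∃ c : ℤ → ℤ, (∀ i, c i ∈ K) ∧ ∀ i, c i < c (i + 1) ∧ ∀ s ∈ K, c i < s → c (i + 1) ≤ s := by
  have hnext : ∀ t, ∃ s, (s ∈ K ∧ t < s) ∧ ∀ r, r ∈ K ∧ t < r → s ≤ r := fun t =>
    Int.exists_least_of_bdd ⟨t, fun r hr => hr.2.le⟩ (hup t)
  have hprev : ∀ t, ∃ s, (s ∈ K ∧ s < t) ∧ ∀ r, r ∈ K ∧ r < t → r ≤ s := fun t =>
    Int.exists_greatest_of_bdd ⟨t, fun r hr => hr.2.le⟩ (hdn t)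
  choose nxt hn1 hn2 using hnext
  choose prv hp1 hp2 using hprev
  obtain ⟨k, hk, -⟩ := hup 0
  -- Predecessor and successor must be inverse to each other for the two half-enumerations to fit
  -- together at `k`.
  have hnp : ∀ t ∈ K, nxt (prv t) = t := fun t ht =>
    le_antisymm (hn2 _ t ⟨ht, (hp1 t).2⟩) (by
      by_contra! hlt
      have h1 := hp2 t _ ⟨(hn1 (prv t)).1, hlt⟩
      have h2 := (hn1 (prv t)).2
      omega)
  have hmem : ∀ n : ℕ, nxt^[n] k ∈ K ∧ prv^[n] k ∈ K := fun n => by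
    cases n with
    | zero => exact ⟨hk, hk⟩
    | succ n =>
      rw [Function.iterate_succ_apply', Function.iterate_succ_apply']
      exact ⟨(hn1 _).1, (hp1 _).1⟩
  let c : ℤ → ℤ := fun i => if 0 ≤ i then nxt^[i.toNat] k else prv^[(-i).toNat] k
  have hc : ∀ i, c (i + 1) = nxt (c i) := by
    intro i
    rcases le_or_gt 0 i with hi | hi
    · simp only [c, if_pos hi, if_pos (show 0 ≤ i + 1 by omega)]
      rw [show (i + 1).toNat = i.toNat + 1 by omega, Function.iterate_succ_apply']
    · obtain ⟨n, rfl⟩ : ∃ n : ℕ, i = -(n + 1) := ⟨(-i - 1).toNat, by omega⟩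
      have h1 : c (-(n + 1)) = prv (prv^[n] k) := by
        simp only [c, if_neg (show ¬ (0 : ℤ) ≤ -(n + 1) by omega)]
        rw [show (-(-((n : ℤ) + 1))).toNat = n + 1 by omega, Function.iterate_succ_apply']
      rw [h1, hnp _ (hmem n).2]
      rcases Nat.eq_zero_or_pos n with rfl | hn
      · simp [c]
      · simp only [c, if_neg (show ¬ (0 : ℤ) ≤ -(n + 1) + 1 by omega)]
        rw [show (-(-((n : ℤ) + 1) + 1)).toNat = n by omega]
  refine ⟨c, fun i => ?_, fun i => ?_⟩
  · by_cases hi : 0 ≤ i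
    · simp only [c, if_pos hi]; exact (hmem _).1
    · simp only [c, if_neg hi]; exact (hmem _).2
  · rw [hc]
    exact ⟨(hn1 _).2, fun s hs hlt => hn2 _ s ⟨hs, hlt⟩⟩

/-- In a compact minimal system the return times to an open set are bounded. -/
theorem IsMinimalSystem.exists_bounded_return {X : Type*} [TopologicalSpace X] [CompactSpace X]
    {T : X ≃ₜ X} (hT : IsMinimalSystem T) {U : Set X} (hU : IsOpen U) (hne : U.Nonempty) :
    ∃ R : ℕ, ∀ x, ∃ s : ℕ, s ≤ R ∧ (T ^ (s : ℤ)) x ∈ U := by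
  obtain ⟨n, hn⟩ := exists_forall_notMem_of_antitone
    (F := fun n : ℕ => ⋂ s ∈ {s : ℤ | |s| ≤ n}, (T ^ s) ⁻¹' Uᶜ)
    (fun n m hnm => Set.biInter_subset_biInter_left fun s (hs : |s| ≤ n) =>
      hs.trans (by exact_mod_cast hnm))
    (fun n => isClosed_biInter fun s _ => hU.isClosed_compl.preimage (T ^ s).continuous)
    (fun x => by
      obtain ⟨_, ⟨t, rfl⟩, ht⟩ := (hT x).exists_mem_open hU hne
      exact ⟨t.natAbs, fun h => Set.mem_iInter₂.1 h t (by simp) ht⟩)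
  refine ⟨2 * n, fun x => ?_⟩
  have h := hn ((T ^ (n : ℤ)) x)
  simp only [Set.mem_iInter, not_forall, Set.mem_preimage, Set.mem_compl_iff, not_not,
    Set.mem_ofPred_eq] at h
  obtain ⟨s, hs, hsU⟩ := h
  rw [abs_le] at hs
  refine ⟨(s + n).toNat, by omega, ?_⟩
  rwa [Int.toNat_of_nonneg (by omega), zpow_add]

namespace OrderedBratteliDiagram

variable {B : OrderedBratteliDiagram}

/-- The first `n` edges of the path are minimal. -/
def IsMinBelow (x : B.PathSpace) (n : ℕ) : Prop := ∀ m < n, IsMin (x.1 m)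

/-- The first `n` edges of the path are maximal. -/
def IsMaxBelow (x : B.PathSpace) (n : ℕ) : Prop := ∀ m < n, IsMax (x.1 m)

/-- The first `n` edges of the path. -/
def initialPath (n : ℕ) (x : B.PathSpace) : ∀ i : Fin n, B.E i := fun i => x.1 i

theorem initialPath_eq_iff {n : ℕ} {x y : B.PathSpace} :
    initialPath n x = initialPath n y ↔ ∀ m < n, x.1 m = y.1 m :=
  ⟨fun h m hm => congrFun h ⟨m, hm⟩, fun h => funext fun i => h i i.2⟩

theorem IsMinBelow.congr {n : ℕ} {x y : B.PathSpace} (h : initialPath n x = initialPath n y)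
    (hx : IsMinBelow x n) : IsMinBelow y n := fun m hm =>
  initialPath_eq_iff.1 h m hm ▸ hx m hm

theorem IsMaxBelow.congr {n : ℕ} {x y : B.PathSpace} (h : initialPath n x = initialPath n y)
    (hx : IsMaxBelow x n) : IsMaxBelow y n := fun m hm =>
  initialPath_eq_iff.1 h m hm ▸ hx m hm

/-- A minimal initial path is determined by its end vertex: going upwards, there is one minimal edge
into each vertex. -/
theorem IsMinBelow.initialPath_eq {n : ℕ} {x y : B.PathSpace} (hx : IsMinBelow x n)
    (hy : IsMinBelow y n) (h : B.source (x.1 n) = B.source (y.1 n)) :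
    initialPath n x = initialPath n y := by
  rw [initialPath_eq_iff]
  induction n with
  | zero => exact fun m hm => absurd hm (Nat.not_lt_zero m)
  | succ n ih =>
    have hn : x.1 n = y.1 n := eq_of_isMin_of_range_eq (hx n n.lt_succ_self) (hy n n.lt_succ_self)
      (by rw [x.2, y.2, h])
    intro m hm
    rcases Nat.lt_succ_iff_lt_or_eq.1 hm with hm' | rfl
    · exact ih (fun k hk => hx k (by omega)) (fun k hk => hy k (by omega)) (by rw [hn]) m hm'
    · exact hn

theorem exists_first_not_isMax {n : ℕ} {x : B.PathSpace} (h : ¬ IsMaxBelow x n) :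
    ∃ k < n, IsMaxBelow x k ∧ ¬ IsMax (x.1 k) := by
  classical
  have hex : ∃ k, k < n ∧ ¬ IsMax (x.1 k) := by
    unfold IsMaxBelow at h
    push Not at h
    exact h
  obtain ⟨h1, h2⟩ := Nat.find_spec hex
  exact ⟨_, h1, fun m hm => by
    by_contra hmax
    exact Nat.find_min hex hm ⟨by omega, hmax⟩, h2⟩

namespace VershikRel

variable {x y x' y' : B.PathSpace}

/-- Both sides say that the carry passes level `n`. If it stops earlier, the edge there is replaced
by its successor, which is not minimal. -/
theorem isMaxBelow_iff (h : B.VershikRel x y) (n : ℕ) : IsMaxBelow x n ↔ IsMinBelow y n := by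
  constructor
  · intro hx m hm
    by_cases hmax : B.IsMaxPath x
    · exact h.1 hmax m
    · obtain ⟨k, hk⟩ := not_forall.1 hmax
      obtain ⟨j, -, hj1, hj2⟩ := exists_first_not_isMax (n := k + 1) (x := x)
        fun hmax => hk (hmax k k.lt_succ_self)
      have hnj : n ≤ j := by
        by_contra! hlt
        exact hj2 (hx j hlt)
      exact (h.2 j hj1 hj2).1 m (hm.trans_le hnj)
  · intro hy
    by_contra hx
    obtain ⟨k, hk, hk1, hk2⟩ := exists_first_not_isMax hx
    have hcov := (h.2 k hk1 hk2).2.1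
    exact hcov.lt.not_isMin (hy k hk)

/-- When the carry stops before level `n`, the first `n` edges of the image depend only on the first
`n` edges of the point. -/
theorem initialPath_eq (h : B.VershikRel x y) (h' : B.VershikRel x' y') {n : ℕ}
    (hx : ¬ IsMaxBelow x n) (he : initialPath n x = initialPath n x') :
    initialPath n y = initialPath n y' := by
  rw [initialPath_eq_iff] at he ⊢
  obtain ⟨k, hk, hk1, hk2⟩ := exists_first_not_isMax hx
  obtain ⟨a1, a2, a3⟩ := h.2 k hk1 hk2
  obtain ⟨b1, b2, b3⟩ := h'.2 k (fun m hm => he m (by omega) ▸ hk1 m hm) (he k hk ▸ hk2)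
  rw [← he k hk] at b2
  have hyk := eq_of_covBy a2 b2
  intro m hm
  rcases lt_trichotomy m k with hmk | rfl | hmk
  · exact initialPath_eq_iff.1 (IsMinBelow.initialPath_eq a1 b1 (by rw [hyk])) m hmk
  · exact hyk
  · rw [a3 m hmk, b3 m hmk, he m hm]

end VershikRel

/-! ### Codings by initial paths and their recognizability -/

section System

variable {X : Type*} [TopologicalSpace X] {T : X ≃ₜ X} {φ : X ≃ₜ B.PathSpace}

/-- The coding of a Bratteli–Vershik system by initial paths of length `n`. -/
def pathCoding (T : X ≃ₜ X) (φ : X ≃ₜ B.PathSpace) (n : ℕ) (x : X) (t : ℤ) : ∀ i : Fin n, B.E i :=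
  initialPath n (φ ((T ^ t) x))

theorem isCoding_pathCoding (T : X ≃ₜ X) (φ : X ≃ₜ B.PathSpace) (n : ℕ) :
    IsCoding T (pathCoding T φ n) := by
  refine ⟨fun t => (IsLocallyConstant.iff_continuous _).2 ?_, fun x t => ?_⟩
  · refine continuous_pi fun i => ?_
    exact (continuous_apply (i : ℕ)).comp (continuous_subtype_val.comp
      (φ.continuous.comp (T ^ t).continuous))
  · unfold pathCoding
    rw [zpow_add_one, Homeomorph.mul_apply]

theorem pathCoding_injOn_levels {x y : X}
    (h : ∀ n, pathCoding T φ n x 0 = pathCoding T φ n y 0) : x = y := by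
  apply φ.injective
  apply Subtype.ext
  funext n
  exact initialPath_eq_iff.1 (h (n + 1)) n n.lt_succ_self

theorem pathCoding_restrict {m n : ℕ} (hmn : m ≤ n) (x : X) (t : ℤ) :
    pathCoding T φ m x t = fun i => pathCoding T φ n x t (Fin.castLE hmn i) := rfl

theorem isClopen_setOf_initialPath (φ : X ≃ₜ B.PathSpace) (n : ℕ)
    (S : Set (∀ i : Fin n, B.E i)) : IsClopen {x | initialPath n (φ x) ∈ S} := by
  have : {x | initialPath n (φ x) ∈ S} = (fun x => pathCoding (1 : X ≃ₜ X) φ n x 0) ⁻¹' S := rfl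
  rw [this]
  exact ⟨⟨by
    rw [← Set.preimage_compl]
    exact (isCoding_pathCoding 1 φ n).locallyConstant 0 _⟩,
    (isCoding_pathCoding 1 φ n).locallyConstant 0 _⟩

variable [CompactSpace X]

/-- The itineraries of a minimal Bratteli–Vershik system are concatenations of words indexed by
the vertices of level `n`. -/
theorem exists_words (hV : ∀ x, B.VershikRel (φ x) (φ (T x))) (hT : IsMinimalSystem T)
    (hB : B.IsProperlyOrdered) (n : ℕ) (hcard : Nat.card (B.V n) ≤ 2) :
    ∃ w : Bool → List (∀ i : Fin n, B.E i), (∀ b, w b ≠ []) ∧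
      ∀ x, ∃ c l, IsFactorization w (pathCoding T φ n x) c l ∧
        ∀ i, IsMinBelow (φ ((T ^ c i) x)) n := by
  classical
  have : Finite (B.V n) := B.finite_V n
  have : Fintype (B.V n) := Fintype.ofFinite _
  obtain ⟨ι⟩ : Nonempty (B.V n ↪ Bool) :=
    Function.Embedding.nonempty_of_card_le (by simpa [Nat.card_eq_fintype_card] using hcard)
  obtain ⟨xmin, hxmin, -⟩ := hB.2
  have hopen : IsOpen {x | IsMinBelow (φ x) n} := by
    have : {x | IsMinBelow (φ x) n} =
        {x | initialPath n (φ x) ∈ {a : ∀ i : Fin n, B.E i | ∀ i, IsMin (a i)}} := by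
      ext x
      exact ⟨fun h i => h i i.2, fun h m hm => h ⟨m, hm⟩⟩
    rw [this]
    exact (isClopen_setOf_initialPath φ n _).isOpen
  have hmem : IsMinBelow (φ (φ.symm xmin)) n := fun m _ => by
    rw [φ.apply_symm_apply]; exact hxmin m
  obtain ⟨R, hR⟩ := hT.exists_bounded_return hopen ⟨_, hmem⟩
  have hret : ∀ x, ∃ r : ℕ, 0 < r ∧ IsMinBelow (φ ((T ^ (r : ℤ)) x)) n := fun x => by
    obtain ⟨s, -, hs⟩ := hR (T x)
    refine ⟨s + 1, s.succ_pos, ?_⟩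
    push_cast
    rwa [zpow_add_one, Homeomorph.mul_apply]
  -- One representative with minimal initial path is chosen per vertex; a value of `Bool` that
  -- labels no such vertex receives an arbitrary minimal point.
  have hrep : ∀ b, ∃ y, IsMinBelow (φ y) n ∧
      ((∃ z, IsMinBelow (φ z) n ∧ ι (B.source ((φ z).1 n)) = b) →
        ι (B.source ((φ y).1 n)) = b) := by
    intro b
    by_cases h : ∃ z, IsMinBelow (φ z) n ∧ ι (B.source ((φ z).1 n)) = b
    · obtain ⟨z, hz, hzb⟩ := h
      exact ⟨z, hz, fun _ => hzb⟩
    · exact ⟨_, hmem, fun h' => absurd h' h⟩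
  choose y hymin hylab using hrep
  let r : X → ℕ := fun x => Nat.find (hret x)
  have hr : ∀ x, 0 < r x ∧ IsMinBelow (φ ((T ^ (r x : ℤ)) x)) n := fun x => Nat.find_spec (hret x)
  have hrmin : ∀ x, ∀ s < r x, 0 < s → ¬ IsMinBelow (φ ((T ^ (s : ℤ)) x)) n :=
    fun x s hs h0 h => Nat.find_min (hret x) hs ⟨h0, h⟩
  have hsucc : ∀ (x : X) (s : ℤ), (T ^ (s + 1)) x = T ((T ^ s) x) := fun x s => by
    rw [add_comm, zpow_one_add, Homeomorph.mul_apply]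
  have hmax : ∀ (x : X) (s : ℤ), IsMaxBelow (φ ((T ^ s) x)) n ↔
      IsMinBelow (φ ((T ^ (s + 1)) x)) n := fun x s => by
    rw [hsucc]
    exact (hV _).isMaxBelow_iff n
  -- Until the first return to a minimal path, no carry passes level `n`, so the end vertex
  -- determines the itinerary and hence the word.
  have hsame : ∀ x x', IsMinBelow (φ x) n → IsMinBelow (φ x') n →
      B.source ((φ x).1 n) = B.source ((φ x').1 n) →
      ∀ s : ℕ, s < r x → pathCoding T φ n x s = pathCoding T φ n x' s := by
    intro x x' hx hx' hsrc s
    induction s with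
    | zero => exact fun _ => hx.initialPath_eq hx' hsrc
    | succ s ih =>
      intro hs
      unfold pathCoding
      push_cast
      rw [hsucc, hsucc]
      refine (hV _).initialPath_eq (hV _) (fun h => ?_) (ih (by omega))
      refine hrmin x (s + 1) hs s.succ_pos ?_
      push_cast
      exact (hmax x s).1 h
  refine ⟨fun b => factorAt (pathCoding T φ n (y b)) 0 (r (y b)), fun b => ?_, fun x => ?_⟩
  · apply List.length_pos_iff.1
    simpa [factorAt] using (hr (y b)).1
  have hback : ∀ t : ℤ, ∃ s : ℕ, s ≤ R ∧ IsMinBelow (φ ((T ^ (t + s)) x)) n := fun t => by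
    obtain ⟨s, hs, hmin⟩ := hR ((T ^ t) x)
    exact ⟨s, hs, by rwa [add_comm, zpow_add, Homeomorph.mul_apply]⟩
  obtain ⟨c, hcK, hc⟩ := exists_enumeration (K := {t | IsMinBelow (φ ((T ^ t) x)) n})
    (fun t => by
      obtain ⟨s, -, hs⟩ := hback (t + 1)
      exact ⟨_, hs, by omega⟩)
    (fun t => by
      obtain ⟨s, hsR, hs⟩ := hback (t - R - 1)
      exact ⟨_, hs, by omega⟩)
  let l : ℤ → Bool := fun i => ι (B.source ((φ ((T ^ c i) x)).1 n))
  have hlsrc : ∀ i, B.source ((φ (y (l i))).1 n) = B.source ((φ ((T ^ c i) x)).1 n) := fun i =>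
    ι.injective (hylab (l i) ⟨_, hcK i, rfl⟩)
  have hread : ∀ i, ∀ s : ℕ, s < r (y (l i)) →
      pathCoding T φ n (y (l i)) s = pathCoding T φ n x (c i + s) := fun i s hs => by
    rw [hsame _ _ (hymin _) (hcK i) (hlsrc i) s hs, (isCoding_pathCoding T φ n).apply_zpow]
    congr 1; ring
  refine ⟨c, l, ⟨fun i => ?_, fun i j hj => ?_⟩, hcK⟩
  · simp only [factorAt, List.length_ofFn]
    obtain ⟨hr0, hrm⟩ := hr (y (l i))
    -- The first return of the representative is seen in its word as a maximal path at the last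
    -- letter, so `x` returns then too; an earlier return of `x` would be one of the representative.
    apply le_antisymm
    · refine (hc i).2 _ ?_ (by omega)
      have h1 := hread i (r (y (l i)) - 1) (by omega)
      have h2 : IsMaxBelow (φ ((T ^ ((r (y (l i)) - 1 : ℕ) : ℤ)) (y (l i)))) n := by
        rw [hmax]
        convert hrm using 4
        omega
      have h3 := (hmax x _).1 (h2.congr h1)
      change IsMinBelow _ n
      convert h3 using 4
      omega
    · by_contra! hlt
      have h0 := (hc i).1
      obtain ⟨s, hs⟩ : ∃ s : ℕ, c (i + 1) = c i + s := ⟨(c (i + 1) - c i).toNat, by omega⟩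
      have h1 := hread i s (by omega)
      refine hrmin (y (l i)) s (by omega) (by omega) (IsMinBelow.congr h1.symm ?_)
      rw [← hs]
      exact hcK (i + 1)
  · simp only [factorAt, List.length_ofFn] at hj
    simp only [factorAt, List.getElem?_ofFn, hj, dite_true, zero_add]
    rw [hread i j hj]

/-- Points with long maximal initial paths have almost the same past. -/
theorem exists_level_common_past (T : X ≃ₜ X) (φ : X ≃ₜ B.PathSpace) (hB : B.IsProperlyOrdered)
    (m L : ℕ) : ∃ n ≥ m, ∀ a b, IsMaxBelow (φ a) n → IsMaxBelow (φ b) n →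
      ∀ s : ℤ, -L ≤ s → s ≤ 0 → pathCoding T φ m a s = pathCoding T φ m b s := by
  obtain ⟨xmax, -, hxmax⟩ := hB.1
  let a₀ := φ.symm xmax
  let G : Set X := ⋂ s ∈ {s : ℤ | -L ≤ s ∧ s ≤ 0},
    {a | pathCoding T φ m a s = pathCoding T φ m a₀ s}
  have hfin : {s : ℤ | -L ≤ s ∧ s ≤ 0}.Finite := Set.finite_Icc _ _
  have hG : IsOpen G := hfin.isOpen_biInter fun s _ =>
    ((isCoding_pathCoding T φ m).locallyConstant s).isOpen_fiber _
  have hcl : ∀ n, IsClosed {a | IsMaxBelow (φ a) n} := fun n => by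
    have : {a | IsMaxBelow (φ a) n} =
        {a | initialPath n (φ a) ∈ {p : ∀ i : Fin n, B.E i | ∀ i, IsMax (p i)}} := by
      ext a
      exact ⟨fun h i => h i i.2, fun h k hk => h ⟨k, hk⟩⟩
    rw [this]
    exact (isClopen_setOf_initialPath φ n _).isClosed
  have hanti : ∀ {n k}, n ≤ k → ∀ {a : X}, IsMaxBelow (φ a) k → IsMaxBelow (φ a) n :=
    fun hnk _ h i hi => h i (hi.trans_le hnk)
  -- Only `a₀` is maximal at all levels, so by compactness the points maximal up to a high level lie
  -- in the neighbourhood `G` of `a₀`, where the relevant past is constant.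
  obtain ⟨n, hn⟩ := exists_forall_notMem_of_antitone
    (F := fun n => {a | IsMaxBelow (φ a) n} ∩ Gᶜ)
    (fun n k hnk a ha => ⟨hanti hnk ha.1, ha.2⟩)
    (fun n => (hcl n).inter hG.isClosed_compl)
    (fun a => by
      by_contra! hcon
      have hmax : B.IsMaxPath (φ a) := fun k => (hcon (k + 1)).1 k k.lt_succ_self
      have ha : a = a₀ := (Equiv.eq_symm_apply φ.toEquiv).2 (hxmax _ hmax)
      refine (hcon 0).2 (Set.mem_iInter₂.2 fun s _ => ?_)
      rw [ha]
      rfl)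
  have hn' : ∀ a, IsMaxBelow (φ a) n → a ∈ G := fun a ha => by
    by_contra hG
    exact hn a ⟨ha, hG⟩
  refine ⟨max m n, le_max_left _ _, fun a b ha hb s hs hs0 => ?_⟩
  have h1 := Set.mem_iInter₂.1 (hn' a (hanti (le_max_right _ _) ha)) s ⟨hs, hs0⟩
  have h2 := Set.mem_iInter₂.1 (hn' b (hanti (le_max_right _ _) hb)) s ⟨hs, hs0⟩
  exact h1.trans h2.symm

/-- Recognizability: if the coding by paths of length `m` is aperiodic, then it is injective. -/
theorem pathCoding_injective (hV : ∀ x, B.VershikRel (φ x) (φ (T x))) (hT : IsMinimalSystem T)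
    (hB : B.IsProperlyOrdered) (hcard : ∀ n, Nat.card (B.V n) ≤ 2) {m : ℕ}
    (hap : IsAperiodicCoding (pathCoding T φ m)) : Function.Injective (pathCoding T φ m) := by
  intro x y hxy
  have hlevel : ∀ n, m ≤ n → pathCoding T φ n x 0 = pathCoding T φ n y 0 := by
    intro n hmn
    obtain ⟨w, hw, hfac⟩ := exists_words hV hT hB n (hcard n)
    obtain ⟨c, l, h, -⟩ := hfac x
    obtain ⟨c', l', h', -⟩ := hfac y
    let g : (∀ i : Fin n, B.E i) → ∀ i : Fin m, B.E i := fun a i => a (Fin.castLE hmn i)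
    have hwg : ∀ b, (w b).map g ≠ [] := fun b => by simpa using hw b
    have hg : IsFactorization (fun b => (w b).map g) (pathCoding T φ m x) c l := h.map g
    have hg' : IsFactorization (fun b => (w b).map g) (pathCoding T φ m y) c' l' := h'.map g
    obtain ⟨q, hq⟩ := exists_isDelay (hap.not_commute hwg hg)
    -- The words of level `n`, read at level `m`, factorize one and the same sequence in two ways. A
    -- common cut to the left of `0` forces equal labels from there on, and equal labels give equal
    -- letters of level `n` at `0`.
    obtain ⟨i, i', hi, hcut⟩ := (isCoding_pathCoding T φ m).exists_common_cut hap hwg hg hg'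
      (t₀ := 0) fun t _ => by rw [hxy]
    have hg'' : IsFactorization (fun b => (w b).map g) (pathCoding T φ m x) c' l' := hxy ▸ hg'
    have hlab := fun s => hg.labels_eq_of_common_cut hwg hq hg'' hcut s
    have hgrow := h.cut_add_le hw i ((-c i).toNat + 1)
    have := IsFactorization.read_eq_of_labels_eq hw h h' (r := (-c i).toNat + 1)
      (fun s _ => hlab s) (t := -c i) (by omega) (by push_cast at hgrow ⊢; omega)
    rwa [← hcut, add_neg_cancel] at this
  refine pathCoding_injOn_levels (T := T) (φ := φ) fun n => ?_
  have h := hlevel (max m n) (le_max_left _ _)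
  rw [pathCoding_restrict (le_max_right m n), pathCoding_restrict (le_max_right m n), h]

/-- In an aperiodic Bratteli–Vershik system with at most two vertices on each level, any two points
that split at `0` from other points have the same past. -/
theorem pathCoding_eq_of_splitsAtZero (hV : ∀ x, B.VershikRel (φ x) (φ (T x)))
    (hT : IsMinimalSystem T) (hB : B.IsProperlyOrdered) (hcard : ∀ n, Nat.card (B.V n) ≤ 2)
    {m : ℕ} (hap : IsAperiodicCoding (pathCoding T φ m)) {x y x' y' : X}
    (hxy : SplitsAtZero (pathCoding T φ m) x y) (hxy' : SplitsAtZero (pathCoding T φ m) x' y')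
    {t : ℤ} (ht : t < 0) : pathCoding T φ m x t = pathCoding T φ m x' t := by
  have hf := isCoding_pathCoding T φ m
  obtain ⟨n, hmn, hpast⟩ := exists_level_common_past T φ hB m (-t).toNat
  obtain ⟨w, hw, hfac⟩ := exists_words hV hT hB n (hcard n)
  let g : (∀ i : Fin n, B.E i) → ∀ i : Fin m, B.E i := fun a i => a (Fin.castLE hmn i)
  have hwg : ∀ b, (w b).map g ≠ [] := fun b => by simpa using hw b
  have hfac' : ∀ x, ∃ c l, IsFactorization (fun b => (w b).map g) (pathCoding T φ m x) c l ∧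
      ∀ i, IsMaxBelow (φ ((T ^ (c i - 1)) x)) n := fun x => by
    obtain ⟨c, l, h, hmin⟩ := hfac x
    refine ⟨c, l, h.map g, fun i => ((hV _).isMaxBelow_iff n).2 ?_⟩
    rw [← Homeomorph.mul_apply, ← zpow_one_add, add_sub_cancel]
    exact hmin i
  obtain ⟨c, l, h, hmax⟩ := hfac' x
  obtain ⟨c', l', h', hmax'⟩ := hfac' x'
  obtain ⟨_, _, hy, -⟩ := hfac' y
  obtain ⟨_, _, hy', -⟩ := hfac' y'
  obtain ⟨q, hq⟩ := exists_isDelay (hap.not_commute hwg h)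
  obtain ⟨i, hi⟩ := hf.exists_cut_eq_neg hap hwg hq h hy hxy
  obtain ⟨i', hi'⟩ := hf.exists_cut_eq_neg hap hwg hq h' hy' hxy'
  by_cases htq : -(q : ℤ) ≤ t
  · have h1 := h.read_common_prefix hwg hq i (j := (t + q).toNat) (by omega)
    have h2 := h'.read_common_prefix hwg hq i' (j := (t + q).toNat) (by omega)
    rw [h1, hi, hi', show -(q : ℤ) + ((t + q).toNat : ℕ) = t by omega] at h2
    exact Option.some_injective _ h2
  -- Just before the cuts at `-q` both points have maximal initial paths, so their pasts agree;
  -- relative to position `-q - 1`, the position `t` is `t + q + 1`.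
  · have := hpast _ _ (hmax i) (hmax' i') (t + q + 1) (by omega) (by omega)
    rw [hf.apply_zpow, hf.apply_zpow, hi, hi'] at this
    convert this using 2 <;> ring

end System

end OrderedBratteliDiagram

open OrderedBratteliDiagram in
/-- A minimal system of topological rank two has exactly one asymptotic component. -/
theorem encard_asymptoticComponents_of_topologicalRank_eq_two {X : Type*} [UniformSpace X]
    [CompactSpace X] [Nonempty X] {T : X ≃ₜ X} (hT : IsMinimalSystem T)
    (hrank : topologicalRank T = 2) : (asymptoticComponents T).encard = 1 := by
  -- An empty set would have infimum `⊤`, so finite rank ensures that the infimum is attained by a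
  -- diagram.
  have hne : {d : ℕ∞ | ∃ k : ℕ, d = k ∧
      ∃ B : OrderedBratteliDiagram, B.Represents T ∧ ∀ n, Nat.card (B.V n) ≤ k}.Nonempty := by
    by_contra hempty
    rw [Set.not_nonempty_iff_eq_empty] at hempty
    rw [topologicalRank, hempty, sInf_empty] at hrank
    exact absurd hrank (by decide)
  obtain ⟨k, hk, B, ⟨-, hB, φ, hφ⟩, hcard⟩ := csInf_mem hne
  rw [← topologicalRank, hrank] at hk
  obtain rfl : 2 = k := by exact_mod_cast hk
  have hV : ∀ x, B.VershikRel (φ x) (φ (T x)) := fun x => by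
    rw [hφ]
    exact (existsUnique_vershikRel hB (φ x)).choose_spec.1
  -- If all path codings were periodic, they would form a separating tower of cyclic factors, and
  -- the rank would be at most one.
  obtain ⟨m, hap⟩ : ∃ m, IsAperiodicCoding (pathCoding T φ m) := by
    by_contra! hper
    obtain ⟨B', hB', hcard'⟩ := exists_represents_of_periodic_codings hT (pathCoding T φ)
      (isCoding_pathCoding T φ) (fun x y => funext fun t => funext fun i => i.elim0)
      (fun n x y h => funext fun t => by
        rw [pathCoding_restrict n.le_succ, pathCoding_restrict n.le_succ, h])
      (fun x y h => pathCoding_injOn_levels fun n => by rw [h n]) hper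
    have hle : topologicalRank T ≤ (1 : ℕ) := sInf_le ⟨1, rfl, B', hB', hcard'⟩
    rw [hrank] at hle
    exact absurd hle (by decide)
  have hf := isCoding_pathCoding T φ m
  have hinj := pathCoding_injective hV hT hB hcard hap
  obtain ⟨x, y, hxy⟩ := hf.exists_splitsAtZero hap
  rw [Set.encard_eq_one]
  refine ⟨asymptoticClass T x, Set.eq_singleton_iff_unique_mem.2
    ⟨hf.asymptoticClass_mem hinj hap hxy, fun C hC => ?_⟩⟩
  obtain ⟨x', y', hxy', rfl⟩ := hf.exists_splitsAtZero_of_mem hinj hC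
  exact hf.asymptoticClass_eq hinj (leftTailEq_of_forall_lt_zero fun t ht =>
    pathCoding_eq_of_splitsAtZero hV hT hB hcard hap hxy' hxy ht)

end Bratteli

theorem mainTheorem6 :
    (∀ (A : Type*) [Fintype A] [UniformSpace A] [DiscreteUniformity A], Fintype.card A = 2 →
      ∀ τ : ℕ → A → List A, (∀ n a, τ n a ≠ []) →
        IsAperiodicSystem (sadicShift τ) → IsMinimalSystem (sadicShift τ) →
          (asymptoticComponents (sadicShift τ)).encard ≤ 2) ∧
    (∀ (X : Type*) [MetricSpace X] (T : X ≃ₜ X),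
      IsCantorSpace X → IsMinimalSystem T → topologicalRank T = 2 →
        (asymptoticComponents T).encard = 1) := by
  refine ⟨fun A _ _ _ hA τ hτ hap _ => encard_asymptoticComponents_sadicShift_le hA τ hτ hap,
    fun X _ T hX hT hrank => ?_⟩
  have := hX.nonempty
  have := hX.compact
  exact encard_asymptoticComponents_of_topologicalRank_eq_two hT hrank
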